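/- **Theorem 5.1.** Let $p$ be a positive integer. Write $H_n=\sum_{k=1}^n \frac1k$ for the harmonic numbers, $\gamma$ for the Euler–Mascheroni constant, $\zeta$ for the Riemann zeta function, $\psi=\Gamma'/\Gamma$ for the logarithmic derivative of the Gamma function, $i$ for the imaginary unit, and $[x]$ for the integer part of $x$. Then each of the four infinite series below converges (as the limit of its partial sums $\sum_{n=1}^N$, $N\to\infty$), and $$ \begin{aligned} &\bigl(1+(-1)^{p+1}\bigr)\sum_{n=1}^\infty\frac{\pi H_n}{n^p\sinh(n\pi)} -\bigl(p+(-1)^{p+1}\bigr)\sum_{n=1}^\infty\frac{\pi}{n^{p+1}\sinh(n\pi)} -\sum_{n=1}^\infty\frac{\pi^2\cosh(n\pi)}{n^p\sinh^2(n\pi)}\\ &+\sum_{n=1}^\infty(-1)^n\frac{\pi\coth(n\pi)}{n^p}\,i^{p+1}\Bigl(\psi(ni)+(-1)^{p+1}\psi(-ni)+\bigl(1+(-1)^{p+1}\bigr)\gamma\Bigr)\\ &+\zeta(p+2)\Bigl\{\bigl(1+(-1)^p\bigr)\bigl(1-2^{-p-1}\bigr)(-1)^{[p/2]+1}-2-(-1)^p\Bigr\}\\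 &-2\bigl(1+(-1)^p\bigr)\sum_{\substack{2n_1+2n_2=p+2\\ n_1,n_2\ge1}}\bigl(1-2^{1-2n_1}\bigr)(-1)^{n_1}\zeta(2n_1)\zeta(2n_2)\\ &+2\sum_{\substack{2n_1+n_2=p+1\\ n_1,n_2\ge1}}\Bigl(1-\bigl(1-2^{1-2n_1}\bigr)(-1)^{n_1}\Bigr)\zeta(2n_1)\zeta(n_2+1)\\ &+4\sum_{\substack{2n_1+2n_2+n_3=p+1\\ n_1,n_2,n_3\ge1}}\bigl(1-2^{1-2n_1}\bigr)(-1)^{n_1}\zeta(2n_1)\zeta(2n_2)\zeta(n_3+1)\;=\;0, \end{aligned} $$ where the finite sums run over tuples of positive integers, and empty sums are $0$. -/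

import Mathlib

open Filter Topology

/-- `SeriesSum f S`: the series `f 1 + f 2 + f 3 + ⋯` converges, in the ordinary sense that its
partial sums `f 1 + ⋯ + f N` tend to a limit, and its sum is `S`. -/
def SeriesSum {E : Type*} [AddCommMonoid E] [TopologicalSpace E] (f : ℕ → E) (S : E) : Prop :=
  Tendsto (fun N : ℕ => ∑ n ∈ Finset.Icc 1 N, f n) atTop (𝓝 S)

/-! The identity says that the residues of π cot(πs) (ψ(-s) + γ) π / (s^p sinh(πs)) add up to zero:
double poles at n ≥ 1, simple poles at -n, poles at ±mi, and a pole at 0 whose residue is a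
convolution of zeta values. No contour integral is used; everything comes from partial fractions.

Truncated to the poles in [-N, N], s π cot(πs) and s (ψ(-s) + γ) are finite expressions in 1/(n - s)
and 1/(n + s), and their product is resolved by algebra alone in `partial_fractions_mul`. That lemma
holds in every commutative ℂ-algebra. In power series it gives the Taylor coefficients c_j of the
product at 0; in ℂ it gives the values at z = ±mi. `truncated_residue_sum` joins the two. As N → ∞
the pole coefficients tend to H_n and H_n - 1/n, which gives `residue_sum`.

Next, `residue_sum` is divided by z^(p+2), weighted by (-1)^m and summed over z = ±mi, 1 ≤ m ≤ M. As
M → ∞ the pole terms become the partial fractions of π / sinh(πn) and π² cosh(πn) / sinh²(πn), while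
the powers of z produce Taylor coefficients of πx / sinh(πx). The missing term m = 0 is c_(p+2). The
result is `tendsto_sum_imaginaryResidue`; expanding its coefficient of x^(p+2) yields the zeta
values and the three finite sums. -/

/-! ### Truncated partial fractions, for numbers and for power series -/

theorem sum_Icc_inv_add (N n : ℕ) :
    ∑ k ∈ Finset.Icc 1 N, ((n : ℂ) + k)⁻¹ = (harmonic (N + n) : ℂ) - harmonic n := by
  induction N with
  | zero => simp
  | succ N ih =>
    rw [Finset.sum_Icc_succ_top (by omega), ih, show N + 1 + n = (N + n) + 1 by ring, harmonic_succ]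
    push_cast
    ring

theorem sum_Icc_inv (N : ℕ) : ∑ k ∈ Finset.Icc 1 N, (k : ℂ)⁻¹ = (harmonic N : ℂ) := by
  simpa using sum_Icc_inv_add N 0

/-- The terms below n give -H_(n-1) after the reflection k ↦ n - k, those above n give H_(N-n). -/
theorem sum_Icc_erase_inv_sub {N n : ℕ} (h1 : 1 ≤ n) (hn : n ≤ N) :
    ∑ k ∈ (Finset.Icc 1 N).erase n, ((k : ℂ) - n)⁻¹ =
      (harmonic (N - n) : ℂ) - harmonic (n - 1) := by
  induction N, hn using Nat.le_induction with
  | base =>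
    rw [Nat.sub_self, harmonic_zero, ← sum_Icc_inv, Rat.cast_zero, zero_sub, ← Finset.sum_neg_distrib]
    refine Finset.sum_bij' (fun k _ => n - k) (fun k _ => n - k) ?_ ?_ ?_ ?_ ?_
    · intro k hk; simp only [Finset.mem_erase, Finset.mem_Icc] at hk ⊢; omega
    · intro k hk; simp only [Finset.mem_erase, Finset.mem_Icc] at hk ⊢; omega
    · intro k hk; simp only [Finset.mem_erase, Finset.mem_Icc] at hk ⊢; omega
    · intro k hk; simp only [Finset.mem_Icc] at hk ⊢; omega
    · intro k hk
      simp only [Finset.mem_erase, Finset.mem_Icc] at hk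
      rw [Nat.cast_sub hk.2.2, ← inv_neg, neg_sub]
  | succ N hN ih =>
    have : (Finset.Icc 1 (N + 1)).erase n = insert (N + 1) ((Finset.Icc 1 N).erase n) := by
      ext k; simp only [Finset.mem_erase, Finset.mem_Icc, Finset.mem_insert]; omega
    rw [this, Finset.sum_insert (by simp), ih, show N + 1 - n = (N - n) + 1 by omega,
      harmonic_succ]
    push_cast [Nat.cast_sub hN]
    ring

/-- Coefficient at the pole `n` of the truncated partial fractions. -/
noncomputable def poleCoeff (N n : ℕ) : ℂ :=
  harmonic n + harmonic N + harmonic (N + n) - 2 * harmonic (N - n)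

/-- Coefficient at the pole `-n` of the truncated partial fractions. -/
noncomputable def negPoleCoeff (N n : ℕ) : ℂ :=
  harmonic n - (n : ℂ)⁻¹ + harmonic N - harmonic (N + n)

/-- E n and D n stand for 1/(n - x) and 1/(n + x), known only through their defining relations, so
that x may be a complex number or the formal variable. Distinct poles split by the two-term partial
fraction; only the diagonal leaves double poles. -/
theorem partial_fractions_mul {R : Type*} [CommRing R] [Algebra ℂ R] (N : ℕ) (x : R)
    (E D : ℕ → R) (hE : ∀ n : ℕ, 1 ≤ n → ((n : R) - x) * E n = 1)
    (hD : ∀ n : ℕ, 1 ≤ n → ((n : R) + x) * D n = 1) :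
    (1 - x * ∑ n ∈ Finset.Icc 1 N, (E n - D n)) *
      (1 - x * ∑ n ∈ Finset.Icc 1 N, (E n - algebraMap ℂ R (n : ℂ)⁻¹)) =
    1 + x ^ 2 * ∑ n ∈ Finset.Icc 1 N,
      (E n ^ 2 - poleCoeff N n • E n + negPoleCoeff N n • D n) := by
  set i : ℕ → R := fun n => algebraMap ℂ R (n : ℂ)⁻¹ with hi
  have hin : ∀ n : ℕ, 1 ≤ n → i n * n = 1 := by
    intro n hn
    rw [hi, ← map_natCast (algebraMap ℂ R) n, ← map_mul, inv_mul_cancel₀, map_one]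
    exact_mod_cast (by omega : n ≠ 0)
  have hE1 : ∀ n : ℕ, 1 ≤ n → E n - i n = x * (i n * E n) := by
    intro n hn
    linear_combination i n * hE n hn - E n * hin n hn
  have hD1 : ∀ n : ℕ, 1 ≤ n → D n - i n = - x * (i n * D n) := by
    intro n hn
    linear_combination i n * hD n hn - D n * hin n hn
  have hEE : ∀ n k : ℕ, 1 ≤ n → 1 ≤ k → n ≠ k →
      E n * E k = ((k : ℂ) - n)⁻¹ • E n + ((n : ℂ) - k)⁻¹ • E k := by
    intro n k hn hk hnk
    have h0 : ((k : ℂ) - n) ≠ 0 := sub_ne_zero.2 (by exact_mod_cast hnk.symm)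
    have h1 : ((n : ℂ) - k)⁻¹ = - ((k : ℂ) - n)⁻¹ := by rw [← inv_neg, neg_sub]
    have h2 : algebraMap ℂ R ((k : ℂ) - n)⁻¹ * ((k : R) - n) = 1 := by
      rw [← map_natCast (algebraMap ℂ R) n, ← map_natCast (algebraMap ℂ R) k, ← map_sub, ← map_mul,
        inv_mul_cancel₀ h0, map_one]
    rw [h1, Algebra.smul_def, Algebra.smul_def, map_neg]
    generalize algebraMap ℂ R ((k : ℂ) - n)⁻¹ = u at h2
    linear_combination (-E n * E k) * h2 + u * E n * hE k hk - u * E k * hE n hn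
  have hDE : ∀ n k : ℕ, 1 ≤ n → 1 ≤ k →
      D n * E k = ((n : ℂ) + k)⁻¹ • D n + ((n : ℂ) + k)⁻¹ • E k := by
    intro n k hn hk
    have h0 : ((n : ℂ) + k) ≠ 0 := by exact_mod_cast (by omega : n + k ≠ 0)
    have h2 : algebraMap ℂ R ((n : ℂ) + k)⁻¹ * ((n : R) + k) = 1 := by
      rw [← map_natCast (algebraMap ℂ R) n, ← map_natCast (algebraMap ℂ R) k, ← map_add, ← map_mul,
        inv_mul_cancel₀ h0, map_one]
    rw [Algebra.smul_def, Algebra.smul_def]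
    generalize algebraMap ℂ R ((n : ℂ) + k)⁻¹ = u at h2
    linear_combination (-D n * E k) * h2 + u * D n * hE k hk + u * E k * hD n hn
  have sEE : (∑ n ∈ Finset.Icc 1 N, E n) * (∑ n ∈ Finset.Icc 1 N, E n) =
      ∑ n ∈ Finset.Icc 1 N, (E n ^ 2 +
        (2 * ((harmonic (N - n) : ℂ) - harmonic (n - 1))) • E n) := by
    have h1 : ∀ n ∈ Finset.Icc 1 N, ∑ k ∈ Finset.Icc 1 N, E n * E k =
        E n ^ 2 + ∑ k ∈ (Finset.Icc 1 N).erase n, ((k : ℂ) - n)⁻¹ • E n +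
          (∑ k ∈ (Finset.Icc 1 N).erase n, ((n : ℂ) - k)⁻¹ • E k) := by
      intro n hn
      rw [← Finset.add_sum_erase _ _ hn, add_assoc, ← Finset.sum_add_distrib, sq]
      congr 1
      refine Finset.sum_congr rfl fun k hk => ?_
      simp only [Finset.mem_erase, Finset.mem_Icc] at hk hn
      exact hEE n k hn.1 hk.2.1 (Ne.symm hk.1)
    -- Exchanging n and k shows that both halves of the off-diagonal sum agree, hence the factor 2.
    have h2 : ∑ n ∈ Finset.Icc 1 N, (∑ k ∈ (Finset.Icc 1 N).erase n, ((n : ℂ) - k)⁻¹ • E k) =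
        ∑ n ∈ Finset.Icc 1 N, (∑ k ∈ (Finset.Icc 1 N).erase n, ((k : ℂ) - n)⁻¹ • E n) := by
      refine Finset.sum_comm' ?_
      intro n k
      simp only [Finset.mem_erase, Finset.mem_Icc]
      tauto
    rw [Finset.sum_mul_sum, Finset.sum_congr rfl h1, Finset.sum_add_distrib, h2,
      ← Finset.sum_add_distrib]
    refine Finset.sum_congr rfl fun n hn => ?_
    simp only [Finset.mem_Icc] at hn
    rw [← Finset.sum_smul, sum_Icc_erase_inv_sub hn.1 hn.2, two_mul, add_smul, add_assoc]
  have sDE : (∑ n ∈ Finset.Icc 1 N, D n) * (∑ n ∈ Finset.Icc 1 N, E n) =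
      ∑ n ∈ Finset.Icc 1 N, (((harmonic (N + n) : ℂ) - harmonic n) • D n +
        ((harmonic (N + n) : ℂ) - harmonic n) • E n) := by
    have h1 : ∀ n ∈ Finset.Icc 1 N, ∑ k ∈ Finset.Icc 1 N, D n * E k =
        ∑ k ∈ Finset.Icc 1 N, ((n : ℂ) + k)⁻¹ • D n +
          (∑ k ∈ Finset.Icc 1 N, ((n : ℂ) + k)⁻¹ • E k) := by
      intro n hn
      rw [← Finset.sum_add_distrib]
      refine Finset.sum_congr rfl fun k hk => ?_
      simp only [Finset.mem_Icc] at hk hn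
      exact hDE n k hn.1 hk.1
    rw [Finset.sum_mul_sum, Finset.sum_congr rfl h1, Finset.sum_add_distrib,
      Finset.sum_comm (f := fun n k : ℕ => ((n : ℂ) + k)⁻¹ • E k), ← Finset.sum_add_distrib]
    refine Finset.sum_congr rfl fun n hn => ?_
    rw [← Finset.sum_smul, ← Finset.sum_smul, sum_Icc_inv_add]
    simp_rw [add_comm _ (n : ℂ)]
    rw [sum_Icc_inv_add]
  have si : ∑ n ∈ Finset.Icc 1 N, i n = algebraMap ℂ R (harmonic N : ℂ) := by
    rw [← sum_Icc_inv, map_sum]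
  -- The linear terms of the product show a single factor x; the second one is extracted from E n -
  -- D n = x (E n + D n) / n, and likewise in `s2`.
  have s1 : ∑ n ∈ Finset.Icc 1 N, (E n - D n) =
      x * ∑ n ∈ Finset.Icc 1 N, ((n : ℂ)⁻¹ • E n + (n : ℂ)⁻¹ • D n) := by
    rw [Finset.mul_sum]
    refine Finset.sum_congr rfl fun n hn => ?_
    rw [Algebra.smul_def, Algebra.smul_def]
    linear_combination hE1 n (Finset.mem_Icc.1 hn).1 - hD1 n (Finset.mem_Icc.1 hn).1
  have s2 : ∑ n ∈ Finset.Icc 1 N, (E n - i n) =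
      x * ∑ n ∈ Finset.Icc 1 N, ((n : ℂ)⁻¹ • E n) := by
    rw [Finset.mul_sum]
    refine Finset.sum_congr rfl fun n hn => ?_
    rw [Algebra.smul_def]
    linear_combination hE1 n (Finset.mem_Icc.1 hn).1
  have s3 : (∑ n ∈ Finset.Icc 1 N, (E n - D n)) * ∑ n ∈ Finset.Icc 1 N, (E n - i n) =
      ∑ n ∈ Finset.Icc 1 N, (E n ^ 2 +
        (2 * ((harmonic (N - n) : ℂ) - harmonic (n - 1))) • E n) -
      ∑ n ∈ Finset.Icc 1 N, (((harmonic (N + n) : ℂ) - harmonic n) • D n +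
        ((harmonic (N + n) : ℂ) - harmonic n) • E n) -
      ∑ n ∈ Finset.Icc 1 N, ((harmonic N : ℂ) • E n - (harmonic N : ℂ) • D n) := by
    rw [← sEE, ← sDE, Finset.sum_sub_distrib, Finset.sum_sub_distrib, si, Finset.sum_sub_distrib,
      ← Finset.smul_sum, ← Finset.smul_sum, Algebra.smul_def, Algebra.smul_def]
    ring
  have key : (1 - x * ∑ n ∈ Finset.Icc 1 N, (E n - D n)) *
      (1 - x * ∑ n ∈ Finset.Icc 1 N, (E n - i n)) = 1 + x ^ 2 *
      (- ∑ n ∈ Finset.Icc 1 N, ((n : ℂ)⁻¹ • E n + (n : ℂ)⁻¹ • D n) -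
        ∑ n ∈ Finset.Icc 1 N, ((n : ℂ)⁻¹ • E n) +
        (∑ n ∈ Finset.Icc 1 N, (E n - D n)) * ∑ n ∈ Finset.Icc 1 N, (E n - i n)) := by
    linear_combination (-x) * s1 + (-x) * s2
  rw [key, s3]
  congr 2
  rw [← Finset.sum_neg_distrib, ← Finset.sum_sub_distrib, ← Finset.sum_sub_distrib,
    ← Finset.sum_sub_distrib, ← Finset.sum_add_distrib]
  refine Finset.sum_congr rfl fun n hn => ?_
  obtain ⟨m, rfl⟩ : ∃ m, n = m + 1 := ⟨n - 1, by have := (Finset.mem_Icc.1 hn).1; omega⟩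
  rw [poleCoeff, negPoleCoeff, Nat.add_sub_cancel, harmonic_succ]
  push_cast
  module

/-- The contribution of the poles `±n`, with coefficients `a` and `b`, to the residue sum of
`(c / (w - n) ^ 2 + a / (w - n) + b / (w + n)) / (w ^ p * (w - z))`. -/
noncomputable def polePart (a b : ℂ) (p n : ℕ) (z : ℂ) : ℂ :=
  (n : ℂ)⁻¹ ^ p * (((n : ℂ) - z)⁻¹ ^ 2 + (p * (n : ℂ)⁻¹ - a) * ((n : ℂ) - z)⁻¹ +
    (-1) ^ p * b * ((n : ℂ) + z)⁻¹)

theorem polePart_zero_right (a b : ℂ) (p n : ℕ) :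
    polePart a b p n 0 = (p + 1) * (n : ℂ)⁻¹ ^ (p + 2) - a * (n : ℂ)⁻¹ ^ (p + 1) +
      (-1) ^ p * b * (n : ℂ)⁻¹ ^ (p + 1) := by
  simp only [polePart, sub_zero, add_zero]
  ring

/-- One step of the geometric expansions of 1/(n - z) and 1/(n + z). Iterated, it makes `polePart a
b j n 0` the j-th Taylor coefficient and leaves an exact remainder. -/
theorem polePart_eq_add_mul (a b : ℂ) (p : ℕ) {n : ℕ} {z : ℂ} (hn : n ≠ 0) (h1 : (n : ℂ) - z ≠ 0)
    (h2 : (n : ℂ) + z ≠ 0) :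
    polePart a b p n z = polePart a b p n 0 + z * polePart a b (p + 1) n z := by
  have h0 : (n : ℂ) ≠ 0 := by exact_mod_cast hn
  simp only [polePart, sub_zero, add_zero, pow_succ, Nat.cast_add, Nat.cast_one]
  have hE : ((n : ℂ) - z)⁻¹ = (n : ℂ)⁻¹ + z * (n : ℂ)⁻¹ * ((n : ℂ) - z)⁻¹ := by
    field_simp
    ring
  have hD : ((n : ℂ) + z)⁻¹ = (n : ℂ)⁻¹ - z * (n : ℂ)⁻¹ * ((n : ℂ) + z)⁻¹ := by
    field_simp
    ring
  set u := (n : ℂ)⁻¹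
  set e := ((n : ℂ) - z)⁻¹
  set d := ((n : ℂ) + z)⁻¹
  linear_combination u ^ p * (e + u + p * u - a) * hE + u ^ p * (-1) ^ p * b * hD

theorem polePart_eq_sum_add (a b : ℂ) (p : ℕ) {n : ℕ} {z : ℂ} (hn : n ≠ 0) (h1 : (n : ℂ) - z ≠ 0)
    (h2 : (n : ℂ) + z ≠ 0) :
    ((n : ℂ) - z)⁻¹ ^ 2 - a * ((n : ℂ) - z)⁻¹ + b * ((n : ℂ) + z)⁻¹ =
      ∑ j ∈ Finset.range p, polePart a b j n 0 * z ^ j + z ^ p * polePart a b p n z := by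
  induction p with
  | zero => simp [polePart]; ring
  | succ p ih =>
    rw [ih, Finset.sum_range_succ, polePart_eq_add_mul a b p hn h1 h2]
    ring

open PowerSeries in
/-- The power series of `π x cot (π x)` truncated to the poles in `[-N, N]`. -/
noncomputable def cotPS (N : ℕ) : PowerSeries ℂ :=
  1 - X * ∑ n ∈ Finset.Icc 1 N,
    (PowerSeries.mk (fun j => (n : ℂ)⁻¹ ^ (j + 1)) -
      PowerSeries.mk (fun j => (-1) ^ j * (n : ℂ)⁻¹ ^ (j + 1)))

open PowerSeries in
/-- The power series of `x (ψ(-x) + γ)` truncated to the poles in `[0, N]`. -/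
noncomputable def digammaPS (N : ℕ) : PowerSeries ℂ :=
  1 - X * ∑ n ∈ Finset.Icc 1 N,
    (PowerSeries.mk (fun j => (n : ℂ)⁻¹ ^ (j + 1)) - algebraMap ℂ (PowerSeries ℂ) (n : ℂ)⁻¹)

theorem cotPS_mul_digammaPS (N : ℕ) :
    cotPS N * digammaPS N = 1 + PowerSeries.X ^ 2 * PowerSeries.mk (fun j =>
      ∑ n ∈ Finset.Icc 1 N, polePart (poleCoeff N n) (negPoleCoeff N n) j n 0) := by
  rw [cotPS, digammaPS, partial_fractions_mul]
  · congr 2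
    ext j
    rw [map_sum, PowerSeries.coeff_mk]
    refine Finset.sum_congr rfl fun n hn => ?_
    -- All j + 1 products in the Cauchy square of the geometric series equal n^(-j-2), whence the
    -- factor j + 1.
    rw [polePart_zero_right, map_add, map_sub, PowerSeries.coeff_smul, PowerSeries.coeff_smul,
      sq, PowerSeries.coeff_mul, Finset.sum_congr rfl (g := fun _ => (n : ℂ)⁻¹ ^ (j + 2))]
    · simp only [PowerSeries.coeff_mk, Finset.sum_const, Finset.Nat.card_antidiagonal, smul_eq_mul,
        nsmul_eq_mul]
      push_cast
      ring
    · intro x hx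
      rw [PowerSeries.coeff_mk, PowerSeries.coeff_mk, ← pow_add, ← Finset.HasAntidiagonal.mem_antidiagonal.1 hx]
      congr 1
      ring
  · intro n hn
    have hn0 : (n : ℂ) ≠ 0 := by exact_mod_cast (by omega : n ≠ 0)
    rw [← map_natCast (PowerSeries.C (R := ℂ)) n]
    ext j
    cases j with
    | zero => simp [sub_mul, hn0]
    | succ j =>
      rw [sub_mul, map_sub, PowerSeries.coeff_C_mul, PowerSeries.coeff_succ_X_mul,
        PowerSeries.coeff_mk, PowerSeries.coeff_mk, PowerSeries.coeff_one, if_neg (by omega),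
        pow_succ _ (j + 1)]
      field_simp
      ring
  · intro n hn
    have hn0 : (n : ℂ) ≠ 0 := by exact_mod_cast (by omega : n ≠ 0)
    rw [← map_natCast (PowerSeries.C (R := ℂ)) n]
    ext j
    cases j with
    | zero => simp [add_mul, hn0]
    | succ j =>
      rw [add_mul, map_add, PowerSeries.coeff_C_mul, PowerSeries.coeff_succ_X_mul,
        PowerSeries.coeff_mk, PowerSeries.coeff_mk, PowerSeries.coeff_one, if_neg (by omega),
        pow_succ _ (j + 1), pow_succ _ j]
      field_simp
      ring

theorem coeff_cotPS_mul_digammaPS (N j : ℕ) :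
    PowerSeries.coeff (j + 2) (cotPS N * digammaPS N) =
      ∑ n ∈ Finset.Icc 1 N, polePart (poleCoeff N n) (negPoleCoeff N n) j n 0 := by
  rw [cotPS_mul_digammaPS, map_add, PowerSeries.coeff_one, if_neg (by omega), zero_add,
    add_comm j 2, add_comm 2 j, PowerSeries.coeff_X_pow_mul, PowerSeries.coeff_mk]

theorem truncated_residue_sum (N p : ℕ) {z : ℂ} (h1 : ∀ n : ℕ, 1 ≤ n → (n : ℂ) - z ≠ 0)
    (h2 : ∀ n : ℕ, 1 ≤ n → (n : ℂ) + z ≠ 0) :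
    (1 - z * ∑ n ∈ Finset.Icc 1 N, (((n : ℂ) - z)⁻¹ - ((n : ℂ) + z)⁻¹)) *
      (1 - z * ∑ n ∈ Finset.Icc 1 N, (((n : ℂ) - z)⁻¹ - (n : ℂ)⁻¹)) =
    ∑ j ∈ Finset.range (p + 2), PowerSeries.coeff j (cotPS N * digammaPS N) * z ^ j +
      z ^ (p + 2) * ∑ n ∈ Finset.Icc 1 N, polePart (poleCoeff N n) (negPoleCoeff N n) p n z := by
  have key := partial_fractions_mul N z (fun n => ((n : ℂ) - z)⁻¹) (fun n => ((n : ℂ) + z)⁻¹)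
    (fun n hn => mul_inv_cancel₀ (h1 n hn)) (fun n hn => mul_inv_cancel₀ (h2 n hn))
  simp only [Algebra.algebraMap_self, RingHom.id_apply, smul_eq_mul] at key
  rw [key, Finset.sum_range_succ', Finset.sum_range_succ']
  have c0 : PowerSeries.coeff 0 (cotPS N * digammaPS N) = 1 := by
    rw [cotPS_mul_digammaPS]; simp
  have c1 : PowerSeries.coeff (0 + 1) (cotPS N * digammaPS N) = 0 := by
    rw [cotPS_mul_digammaPS, pow_two, mul_assoc]
    simp [PowerSeries.coeff_one, PowerSeries.coeff_succ_X_mul]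
  have h3 : ∑ n ∈ Finset.Icc 1 N, (((n : ℂ) - z)⁻¹ ^ 2 - poleCoeff N n * ((n : ℂ) - z)⁻¹ +
      negPoleCoeff N n * ((n : ℂ) + z)⁻¹) =
      ∑ j ∈ Finset.range p, PowerSeries.coeff (j + 2) (cotPS N * digammaPS N) * z ^ j +
      z ^ p * ∑ n ∈ Finset.Icc 1 N, polePart (poleCoeff N n) (negPoleCoeff N n) p n z := by
    simp_rw [coeff_cotPS_mul_digammaPS, Finset.sum_mul, Finset.mul_sum]
    rw [Finset.sum_comm, ← Finset.sum_add_distrib]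
    refine Finset.sum_congr rfl fun n hn => ?_
    have hn1 := (Finset.mem_Icc.1 hn).1
    exact polePart_eq_sum_add _ _ p (by omega) (h1 n hn1) (h2 n hn1)
  rw [c0, c1, h3, mul_add, Finset.mul_sum]
  have h4 : ∀ j ∈ Finset.range p, z ^ 2 * (PowerSeries.coeff (j + 2) (cotPS N * digammaPS N) * z ^ j)
      = PowerSeries.coeff (j + 1 + 1) (cotPS N * digammaPS N) * z ^ (j + 1 + 1) := by
    intro j _
    ring
  rw [Finset.sum_congr rfl h4]
  ring

/-! ### The series of the digamma function -/

theorem hasDerivAt_log_Gamma {x : ℝ} (hx : 0 < x) :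
    HasDerivAt (fun y => Real.log (Real.Gamma y)) (logDeriv Real.Gamma x) x := by
  have h := (Real.differentiableAt_Gamma (s := x) fun m => by
    have : (0 : ℝ) ≤ m := m.cast_nonneg
    linarith).hasDerivAt.log (Real.Gamma_pos_of_pos hx).ne'
  exact h

theorem logDeriv_Gamma_add_one {x : ℝ} (hx : 0 < x) :
    logDeriv Real.Gamma (x + 1) = logDeriv Real.Gamma x + x⁻¹ := by
  have h1 : HasDerivAt (fun y => Real.log (Real.Gamma (y + 1))) (logDeriv Real.Gamma (x + 1)) x :=
    (hasDerivAt_log_Gamma (by linarith : 0 < x + 1)).comp_add_const x 1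
  have h2 := (hasDerivAt_log_Gamma hx).add (Real.hasDerivAt_log hx.ne')
  refine h1.unique (h2.congr_of_eventuallyEq ?_)
  filter_upwards [eventually_gt_nhds hx] with y hy
  rw [Real.Gamma_add_one hy.ne', Real.log_mul hy.ne' (Real.Gamma_pos_of_pos hy).ne', add_comm]
  rfl

/-- By the functional equation the slope of log Γ over [x, x + 1] is log x; by convexity it is at
most the derivative at the right end. The left end gives the companion bound. -/
theorem log_le_logDeriv_Gamma_add_one {x : ℝ} (hx : 0 < x) :
    Real.log x ≤ logDeriv Real.Gamma (x + 1) := by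
  have h := Real.convexOn_log_Gamma.slope_le_deriv (x := x) (y := x + 1) hx
    (by show (0 : ℝ) < x + 1; linarith) (by linarith)
    (hasDerivAt_log_Gamma (by linarith : 0 < x + 1)).differentiableAt
  have e : deriv (Real.log ∘ Real.Gamma) (x + 1) = logDeriv Real.Gamma (x + 1) :=
    (hasDerivAt_log_Gamma (by linarith : 0 < x + 1)).deriv
  rw [e, slope_def_field, add_sub_cancel_left, div_one, Function.comp_apply, Function.comp_apply,
    Real.Gamma_add_one hx.ne', Real.log_mul hx.ne' (Real.Gamma_pos_of_pos hx).ne',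
    add_sub_cancel_right] at h
  exact h

theorem logDeriv_Gamma_le_log {x : ℝ} (hx : 0 < x) : logDeriv Real.Gamma x ≤ Real.log x := by
  have h := Real.convexOn_log_Gamma.deriv_le_slope (x := x) (y := x + 1) hx
    (by show (0 : ℝ) < x + 1; linarith) (by linarith) (hasDerivAt_log_Gamma hx).differentiableAt
  have e : deriv (Real.log ∘ Real.Gamma) x = logDeriv Real.Gamma x :=
    (hasDerivAt_log_Gamma hx).deriv
  rw [e, slope_def_field, add_sub_cancel_left, div_one, Function.comp_apply, Function.comp_apply,
    Real.Gamma_add_one hx.ne', Real.log_mul hx.ne' (Real.Gamma_pos_of_pos hx).ne',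
    add_sub_cancel_right] at h
  exact h

theorem tendsto_log_add_sub_log (c : ℝ) :
    Tendsto (fun N : ℕ => Real.log (c + N) - Real.log N) atTop (𝓝 0) := by
  have h1 : Tendsto (fun N : ℕ => c / (N : ℝ) + 1) atTop (𝓝 1) := by
    simpa using (tendsto_const_div_atTop_nhds_zero_nat c).add_const 1
  have h2 := (Real.continuousAt_log (one_ne_zero)).tendsto.comp h1
  rw [Real.log_one] at h2
  refine h2.congr' ?_
  filter_upwards [eventually_gt_atTop 0, tendsto_natCast_atTop_atTop.eventually_gt_atTop (-c)]
    with N hN hc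
  have hN' : (N : ℝ) ≠ 0 := by positivity
  rw [← Real.log_div (by linarith) hN', Function.comp_apply]
  congr 1
  field_simp

theorem sum_range_inv_add_eq_logDeriv_Gamma {x : ℝ} (hx : 0 < x) (N : ℕ) :
    ∑ k ∈ Finset.range N, ((k : ℝ) + 1 + x)⁻¹ =
      logDeriv Real.Gamma (x + N + 1) - logDeriv Real.Gamma (x + 1) := by
  induction N with
  | zero => simp
  | succ N ih =>
    rw [Finset.sum_range_succ, ih, Nat.cast_succ, show x + ((N : ℝ) + 1) + 1 = (x + N + 1) + 1 by ring,
      logDeriv_Gamma_add_one (x := x + N + 1) (by positivity), show (N : ℝ) + 1 + x = x + N + 1 by ring]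
    ring

theorem harmonic_eq_sum_range_inv (N : ℕ) :
    (harmonic N : ℝ) = ∑ k ∈ Finset.range N, ((k : ℝ) + 1)⁻¹ := by
  simp [harmonic]

/-- The shifted sum telescopes to ψ(x + N + 1) - ψ(x + 1). The convexity bounds squeeze ψ(x + N + 1)
- log N to 0, and H_N - log N tends to γ. -/
theorem tendsto_sum_logDeriv_Gamma {x : ℝ} (hx : 0 < x) :
    Tendsto (fun N : ℕ => ∑ k ∈ Finset.range N, (((k : ℝ) + 1)⁻¹ - ((k : ℝ) + 1 + x)⁻¹)) atTop
      (𝓝 (logDeriv Real.Gamma (x + 1) + Real.eulerMascheroniConstant)) := by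
  have h1 : Tendsto (fun N : ℕ => logDeriv Real.Gamma (x + N + 1) - Real.log N) atTop (𝓝 0) := by
    refine tendsto_of_tendsto_of_tendsto_of_le_of_le (tendsto_log_add_sub_log x)
      (tendsto_log_add_sub_log (x + 1)) (fun N => ?_) (fun N => ?_)
    · exact sub_le_sub_right (log_le_logDeriv_Gamma_add_one (by positivity)) _
    · refine sub_le_sub_right ?_ _
      rw [show x + 1 + (N : ℝ) = x + N + 1 by ring]
      exact logDeriv_Gamma_le_log (by positivity)
  have h2 := (Real.tendsto_harmonic_sub_log.sub h1).add_const (logDeriv Real.Gamma (x + 1))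
  rw [sub_zero, add_comm Real.eulerMascheroniConstant] at h2
  refine h2.congr fun N => ?_
  rw [Finset.sum_sub_distrib, sum_range_inv_add_eq_logDeriv_Gamma hx, ← harmonic_eq_sum_range_inv]
  ring

theorem digamma_ofReal {x : ℝ} (hx : 0 < x) :
    Complex.digamma x = ((logDeriv Real.Gamma x : ℝ) : ℂ) := by
  have hc : DifferentiableAt ℂ Complex.Gamma (x : ℂ) := by
    refine Complex.differentiableAt_Gamma _ fun m => ?_
    rw [← Complex.ofReal_natCast, ← Complex.ofReal_neg, Ne, Complex.ofReal_inj]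
    have : (0 : ℝ) ≤ m := m.cast_nonneg
    linarith
  have hr : DifferentiableAt ℝ Real.Gamma x := Real.differentiableAt_Gamma fun m => by
    have : (0 : ℝ) ≤ m := m.cast_nonneg
    linarith
  have h1 : HasDerivAt (fun y : ℝ => Complex.Gamma y) (deriv Complex.Gamma x) x :=
    hc.hasDerivAt.comp_ofReal
  have h2 : HasDerivAt (fun y : ℝ => Complex.Gamma y) ((deriv Real.Gamma x : ℝ) : ℂ) x := by
    simp_rw [Complex.Gamma_ofReal]
    exact hr.hasDerivAt.ofReal_comp
  rw [Complex.digamma_def, logDeriv_apply, logDeriv_apply, h1.unique h2, Complex.Gamma_ofReal,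
    Complex.ofReal_div]

theorem norm_inv_sub_inv_le {w : ℂ} {R : ℝ} (hw : -(1 / 2) < w.re) (hR : ‖w‖ ≤ R) (k : ℕ) :
    ‖((k : ℂ) + 1)⁻¹ - ((k : ℂ) + 1 + w)⁻¹‖ ≤ 2 * R * (((k : ℝ) + 1) ^ 2)⁻¹ := by
  have hk : (0 : ℝ) ≤ k := k.cast_nonneg
  have h1 : ((k : ℝ) + 1) / 2 ≤ ‖(k : ℂ) + 1 + w‖ := by
    refine le_trans ?_ (Complex.re_le_norm _)
    simp
    linarith
  have h2 : ‖(k : ℂ) + 1‖ = (k : ℝ) + 1 := by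
    have := Complex.norm_natCast (k + 1)
    push_cast at this
    exact this
  have h3 : (k : ℂ) + 1 ≠ 0 := by rw [← norm_pos_iff, h2]; positivity
  have h4 : (k : ℂ) + 1 + w ≠ 0 := by rw [← norm_pos_iff]; linarith
  have h5 : ((k : ℂ) + 1)⁻¹ - ((k : ℂ) + 1 + w)⁻¹ = w * ((k : ℂ) + 1)⁻¹ * ((k : ℂ) + 1 + w)⁻¹ := by
    field_simp
    ring
  have h6 : ‖(k : ℂ) + 1 + w‖⁻¹ ≤ (((k : ℝ) + 1) / 2)⁻¹ := inv_anti₀ (by positivity) h1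
  rw [h5, norm_mul, norm_mul, norm_inv, norm_inv, h2]
  calc ‖w‖ * ((k : ℝ) + 1)⁻¹ * ‖(k : ℂ) + 1 + w‖⁻¹
      ≤ R * ((k : ℝ) + 1)⁻¹ * (((k : ℝ) + 1) / 2)⁻¹ := by
        have : 0 ≤ R := (norm_nonneg w).trans hR
        gcongr
    _ = 2 * R * (((k : ℝ) + 1) ^ 2)⁻¹ := by field_simp

theorem summable_inv_succ_sq : Summable fun k : ℕ => (((k : ℝ) + 1) ^ 2)⁻¹ := by
  have := (summable_nat_add_iff 1).2 (Real.summable_nat_pow_inv.2 one_lt_two)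
  simpa using this

/-- Both sides are analytic and agree on positive reals, so the identity theorem applies. The bound
on the real part keeps |k + 1 + w| ≥ (k + 1)/2, which makes the series locally uniformly convergent.
-/
theorem hasSum_digamma_add_one {w : ℂ} (hw : -(1 / 2) < w.re) :
    HasSum (fun k : ℕ => ((k : ℂ) + 1)⁻¹ - ((k : ℂ) + 1 + w)⁻¹)
      (Complex.digamma (w + 1) + Real.eulerMascheroniConstant) := by
  -- The ball of radius R contains w and the real points 1 + 1/(n + 1) ≤ 2 used below, which
  -- accumulate at 1 without reaching it.
  set R : ℝ := ‖w‖ + 3 with hR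
  have hs : Summable fun k : ℕ => 2 * R * (((k : ℝ) + 1) ^ 2)⁻¹ := summable_inv_succ_sq.mul_left _
  have hsw : ∀ v : ℂ, -(1 / 2) < v.re → ‖v‖ < R →
      Summable fun k : ℕ => ((k : ℂ) + 1)⁻¹ - ((k : ℂ) + 1 + v)⁻¹ := fun v hv hvR =>
    Summable.of_norm_bounded hs fun k => norm_inv_sub_inv_le hv hvR.le k
  set U : Set ℂ := {v | -(1 / 2) < v.re} ∩ Metric.ball 0 R with hU
  have hUo : IsOpen U := (isOpen_lt continuous_const Complex.continuous_re).inter Metric.isOpen_ball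
  have hUc : IsPreconnected U :=
    ((convex_halfSpace_re_gt _).inter (convex_ball 0 R)).isPreconnected
  have hf : AnalyticOnNhd ℂ
      (fun v : ℂ => ∑' k : ℕ, (((k : ℂ) + 1)⁻¹ - ((k : ℂ) + 1 + v)⁻¹)) U := by
    refine DifferentiableOn.analyticOnNhd ?_ hUo
    refine Complex.differentiableOn_tsum_of_summable_norm hs (fun k v hv => ?_) hUo
      (fun k v hv => norm_inv_sub_inv_le hv.1 (mem_ball_zero_iff.1 hv.2).le k)
    have hne : (k : ℂ) + 1 + v ≠ 0 := by
      intro h0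
      have := congrArg Complex.re h0
      have hv1 : -(1 / 2) < v.re := hv.1
      have hk : (0 : ℝ) ≤ k := k.cast_nonneg
      simp at this
      linarith
    exact ((differentiableAt_const _).sub
      (((differentiableAt_const _).add differentiableAt_id).inv hne)).differentiableWithinAt
  have hG : AnalyticOnNhd ℂ Complex.Gamma {s | 0 < s.re} := by
    refine DifferentiableOn.analyticOnNhd (fun s hs => ?_)
      (isOpen_lt continuous_const Complex.continuous_re)
    refine (Complex.differentiableAt_Gamma s fun m hm => ?_).differentiableWithinAt
    have hs' : 0 < s.re := hs
    rw [hm] at hs'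
    have hm0 : (0 : ℝ) ≤ m := m.cast_nonneg
    simp at hs'
    linarith
  have hg : AnalyticOnNhd ℂ
      (fun v : ℂ => Complex.digamma (v + 1) + Real.eulerMascheroniConstant) U := by
    intro v hv
    have hv1 : 0 < (v + 1).re := by
      have : -(1 / 2) < v.re := hv.1
      simp
      linarith
    refine AnalyticAt.add ?_ analyticAt_const
    have h1 : AnalyticAt ℂ Complex.digamma (v + 1) :=
      (hG.deriv _ hv1).div (hG _ hv1) (Complex.Gamma_ne_zero_of_re_pos hv1)
    exact AnalyticAt.fun_comp h1 (analyticAt_id.add analyticAt_const)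
  have hreal : ∀ x : ℝ, 0 < x → x < R →
      ∑' k : ℕ, (((k : ℂ) + 1)⁻¹ - ((k : ℂ) + 1 + (x : ℂ))⁻¹) =
        Complex.digamma (x + 1) + Real.eulerMascheroniConstant := by
    intro x hx hxR
    have h1 := (hsw x (by simp; linarith) (by
      rwa [Complex.norm_real, Real.norm_of_nonneg hx.le])).hasSum.tendsto_sum_nat
    have h2 := (Complex.continuous_ofReal.tendsto _).comp (tendsto_sum_logDeriv_Gamma hx)
    refine tendsto_nhds_unique h1 ?_
    have h3 := digamma_ofReal (by linarith : 0 < x + 1)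
    push_cast at h3
    rw [h3]
    push_cast [Function.comp_def] at h2
    exact h2
  have h1U : (1 : ℂ) ∈ U := by
    refine ⟨by show -(1 / 2) < (1 : ℂ).re; simp; norm_num, ?_⟩
    rw [mem_ball_zero_iff, norm_one]
    linarith [norm_nonneg w]
  have hfreq : ∃ᶠ v in 𝓝[≠] (1 : ℂ),
      ∑' k : ℕ, (((k : ℂ) + 1)⁻¹ - ((k : ℂ) + 1 + v)⁻¹) =
        Complex.digamma (v + 1) + Real.eulerMascheroniConstant := by
    have ht : Tendsto (fun n : ℕ => ((1 + 1 / ((n : ℝ) + 1) : ℝ) : ℂ)) atTop (𝓝[≠] (1 : ℂ)) := by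
      refine tendsto_nhdsWithin_iff.2 ⟨?_, Eventually.of_forall fun n => ?_⟩
      · have := (tendsto_one_div_add_atTop_nhds_zero_nat (𝕜 := ℝ)).const_add 1
        rw [add_zero] at this
        have h2 := (Complex.continuous_ofReal.tendsto _).comp this
        rwa [Complex.ofReal_one] at h2
      · rw [Set.mem_compl_singleton_iff, ← Complex.ofReal_one, Ne, Complex.ofReal_inj]
        have : 0 < 1 / ((n : ℝ) + 1) := by positivity
        linarith
    refine ht.frequently (Frequently.of_forall fun n => ?_)
    refine hreal _ (by positivity) ?_
    have : 1 / ((n : ℝ) + 1) ≤ 1 := by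
      rw [div_le_one (by positivity)]
      linarith [(n.cast_nonneg : (0 : ℝ) ≤ n)]
    linarith [norm_nonneg w]
  have hwU : w ∈ U := ⟨hw, by rw [mem_ball_zero_iff]; linarith⟩
  have := hf.eqOn_of_preconnected_of_frequently_eq hg hUc h1U hfreq hwU
  simp only at this
  rw [← this]
  exact (hsw w hw (by linarith)).hasSum

/-! ### Partial fractions of π / sin, π / sinh and their derivatives -/

/-- The index k stands for the integer k + 1, so odd k are the even integers. For the series below
their subsum is the full series at z/2, which turns cot and 1/sin² into their alternating versions
by the duplication formulas. -/
theorem hasSum_alternating_of_odd {F : ℕ → ℂ} {A B : ℂ} (hF : HasSum F A)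
    (hB : HasSum (fun j => F (2 * j + 1)) B) :
    HasSum (fun k => (-1) ^ (k + 1) * F k) (2 * B - A) := by
  have hinj : Function.Injective fun j : ℕ => 2 * j + 1 := fun a b h => by simpa using h
  have hG : HasSum (fun k => if Odd k then F k else 0) B := by
    rw [← hinj.hasSum_iff]
    · refine hB.congr_fun fun j => ?_
      simp
    · intro k hk
      rw [if_neg]
      rintro ⟨j, rfl⟩
      exact hk ⟨j, rfl⟩
  refine ((hG.mul_left 2).sub hF).congr_fun fun k => ?_
  rcases Nat.even_or_odd k with h | h
  · rw [if_neg (Nat.not_odd_iff_even.2 h), h.add_one.neg_one_pow]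
    ring
  · rw [if_pos h, h.add_one.neg_one_pow]
    ring

theorem hasSum_cotTerm {z : ℂ} (hz : 0 < z.im) :
    HasSum (fun k : ℕ => (z - (k + 1))⁻¹ + (z + (k + 1))⁻¹)
      (Real.pi * Complex.cot (Real.pi * z) - z⁻¹) := by
  have hz' := UpperHalfPlane.coe_mem_integerComplement ⟨z, hz⟩
  have h1 := cot_series_rep' hz'
  have h2 := (summable_cotTerm hz').hasSum
  simp only [cotTerm, one_div] at h1 h2
  rw [← h1] at h2
  exact h2

theorem sin_pi_mul_ne_zero_of_im_pos {z : ℂ} (hz : 0 < z.im) : Complex.sin (Real.pi * z) ≠ 0 :=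
  sin_pi_mul_ne_zero (UpperHalfPlane.coe_mem_integerComplement ⟨z, hz⟩)

theorem hasSum_int_inv_sq {z : ℂ} (hz : 0 < z.im) :
    HasSum (fun n : ℤ => ((z + n) ^ 2)⁻¹) (Real.pi ^ 2 / Complex.sin (Real.pi * z) ^ 2) := by
  have h1 := iteratedDerivWithin_cot_pi_mul_eq_mul_tsum_div_pow le_rfl (z := z) hz
  have hd : HasDerivAt (fun x : ℂ => Real.pi * Complex.cot (Real.pi * x))
      (-(Real.pi ^ 2 / Complex.sin (Real.pi * z) ^ 2)) z := by
    have hs := sin_pi_mul_ne_zero_of_im_pos hz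
    have hl : HasDerivAt (fun x : ℂ => Real.pi * x) (Real.pi : ℂ) z := by
      simpa using (hasDerivAt_id z).const_mul (Real.pi : ℂ)
    have := ((hl.ccos.div hl.csin hs).const_mul (Real.pi : ℂ))
    refine this.congr_deriv ?_
    field_simp
    linear_combination (-1 : ℂ) * Complex.sin_sq_add_cos_sq (Real.pi * z)
  rw [iteratedDerivWithin_one, (hd.hasDerivWithinAt).derivWithin
    (UpperHalfPlane.isOpen_upperHalfPlaneSet.uniqueDiffOn z hz)] at h1
  have h2 : Summable fun n : ℤ => ((z + n) ^ 2)⁻¹ := by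
    simpa using EisensteinSeries.linear_right_summable z 1 (k := 2) le_rfl
  have h3 : ∑' n : ℤ, ((z + n) ^ 2)⁻¹ = Real.pi ^ 2 / Complex.sin (Real.pi * z) ^ 2 := by
    simp only [pow_one, Nat.factorial_one, Nat.cast_one, mul_one, one_div, neg_mul, one_mul,
      neg_inj, Nat.reduceAdd] at h1
    exact h1.symm
  rw [← h3]
  exact h2.hasSum

theorem hasSum_nat_inv_sq {z : ℂ} (hz : 0 < z.im) :
    HasSum (fun k : ℕ => (z - (k + 1))⁻¹ ^ 2 + (z + (k + 1))⁻¹ ^ 2)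
      (Real.pi ^ 2 / Complex.sin (Real.pi * z) ^ 2 - z⁻¹ ^ 2) := by
  have h := (hasSum_int_inv_sq hz).nat_add_neg
  rw [← hasSum_nat_add_iff' 1] at h
  simp only [Finset.sum_range_one, Int.cast_neg, Int.cast_natCast, Nat.cast_zero, neg_zero,
    Int.cast_zero, add_zero, Nat.cast_add, Nat.cast_one] at h
  convert! h using 1
  · ext k
    rw [inv_pow, inv_pow, add_comm, ← sub_eq_add_neg]
    push_cast
    rfl
  · rw [inv_pow]
    ring

theorem hasSum_alternating_inv {z : ℂ} (hz : 0 < z.im) :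
    HasSum (fun k : ℕ => (-1) ^ (k + 1) * ((z - (k + 1))⁻¹ + (z + (k + 1))⁻¹))
      (Real.pi / Complex.sin (Real.pi * z) - z⁻¹) := by
  have hz2 : 0 < (z / 2).im := by
    rw [Complex.div_ofNat_im]
    positivity
  have h2 := (hasSum_cotTerm hz2).mul_left (1 / 2)
  have h := hasSum_alternating_of_odd (hasSum_cotTerm hz) (h2.congr_fun fun j => ?_)
  · convert! h using 1
    have hs := sin_pi_mul_ne_zero_of_im_pos hz
    have hs2 := sin_pi_mul_ne_zero_of_im_pos hz2
    have e : (Real.pi : ℂ) * z = 2 * (Real.pi * (z / 2)) := by ring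
    have hz0 : z ≠ 0 := by rintro rfl; simp at hz
    rw [Complex.cot, Complex.cot]
    rw [e] at hs ⊢
    generalize (Real.pi : ℂ) * (z / 2) = y at *
    rw [Complex.sin_two_mul] at hs ⊢
    rw [Complex.cos_two_mul]
    have hc : Complex.cos y ≠ 0 := right_ne_zero_of_mul hs
    field_simp
    ring
  · have e1 : z - (((2 * j + 1 : ℕ) : ℂ) + 1) = 2 * (z / 2 - (j + 1)) := by push_cast; ring
    have e2 : z + (((2 * j + 1 : ℕ) : ℂ) + 1) = 2 * (z / 2 + (j + 1)) := by push_cast; ring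
    rw [e1, e2, mul_inv, mul_inv]
    ring

theorem hasSum_alternating_inv_sq {z : ℂ} (hz : 0 < z.im) :
    HasSum (fun k : ℕ => (-1) ^ (k + 1) * ((z - (k + 1))⁻¹ ^ 2 + (z + (k + 1))⁻¹ ^ 2))
      (Real.pi ^ 2 * Complex.cos (Real.pi * z) / Complex.sin (Real.pi * z) ^ 2 - z⁻¹ ^ 2) := by
  have hz2 : 0 < (z / 2).im := by
    rw [Complex.div_ofNat_im]
    positivity
  have h2 := (hasSum_nat_inv_sq hz2).mul_left (1 / 4)
  have h := hasSum_alternating_of_odd (hasSum_nat_inv_sq hz) (h2.congr_fun fun j => ?_)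
  · convert! h using 1
    have hs := sin_pi_mul_ne_zero_of_im_pos hz
    have hs2 := sin_pi_mul_ne_zero_of_im_pos hz2
    have e : (Real.pi : ℂ) * z = 2 * (Real.pi * (z / 2)) := by ring
    have hz0 : z ≠ 0 := by rintro rfl; simp at hz
    rw [e] at hs ⊢
    generalize (Real.pi : ℂ) * (z / 2) = y at *
    rw [Complex.sin_two_mul] at hs ⊢
    rw [Complex.cos_two_mul]
    have hc : Complex.cos y ≠ 0 := right_ne_zero_of_mul hs
    field_simp
    ring
  · have e1 : z - (((2 * j + 1 : ℕ) : ℂ) + 1) = 2 * (z / 2 - (j + 1)) := by push_cast; ring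
    have e2 : z + (((2 * j + 1 : ℕ) : ℂ) + 1) = 2 * (z / 2 + (j + 1)) := by push_cast; ring
    rw [e1, e2, mul_inv, mul_inv]
    ring

theorem sum_Icc_eq_sum_range_succ {E : Type*} [AddCommMonoid E] (f : ℕ → E) (N : ℕ) :
    ∑ n ∈ Finset.Icc 1 N, f n = ∑ k ∈ Finset.range N, f (k + 1) := by
  rw [Finset.range_eq_Ico, Finset.sum_Ico_add' f 0 N 1]
  rfl

theorem inv_sub_mul_I (n m : ℂ) : (n - m * Complex.I)⁻¹ = Complex.I * (n * Complex.I + m)⁻¹ := by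
  rw [show n - m * Complex.I = Complex.I⁻¹ * (n * Complex.I + m) by
    rw [Complex.inv_I]; linear_combination n * Complex.I_sq, mul_inv, inv_inv]

theorem inv_add_mul_I (n m : ℂ) : (n + m * Complex.I)⁻¹ = Complex.I * (n * Complex.I - m)⁻¹ := by
  rw [show n + m * Complex.I = Complex.I⁻¹ * (n * Complex.I - m) by
    rw [Complex.inv_I]; linear_combination n * Complex.I_sq, mul_inv, inv_inv]

theorem tendsto_pi_div_sinh {n : ℕ} (hn : 1 ≤ n) :
    Tendsto (fun M : ℕ => (n : ℂ)⁻¹ + ∑ m ∈ Finset.Icc 1 M, (-1) ^ m *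
      (((n : ℂ) - m * Complex.I)⁻¹ + ((n : ℂ) + m * Complex.I)⁻¹)) atTop
      (𝓝 (Real.pi / Complex.sinh (n * Real.pi))) := by
  have hn0 : (n : ℂ) ≠ 0 := by exact_mod_cast (by omega : n ≠ 0)
  have hz : 0 < ((n : ℂ) * Complex.I).im := by simp; omega
  have h := (((hasSum_alternating_inv hz).mul_left Complex.I).tendsto_sum_nat).const_add (n : ℂ)⁻¹
  convert! h using 2 with M
  · congr 1
    rw [sum_Icc_eq_sum_range_succ]
    refine Finset.sum_congr rfl fun k _ => ?_
    rw [inv_sub_mul_I, inv_add_mul_I]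
    push_cast
    ring
  · have hs := sin_pi_mul_ne_zero_of_im_pos hz
    rw [← mul_assoc, Complex.sin_mul_I, mul_comm (Real.pi : ℂ)] at hs ⊢
    have hs' := left_ne_zero_of_mul hs
    field_simp
    ring

theorem tendsto_pi_sq_mul_cosh_div_sinh_sq {n : ℕ} (hn : 1 ≤ n) :
    Tendsto (fun M : ℕ => (n : ℂ)⁻¹ ^ 2 + ∑ m ∈ Finset.Icc 1 M, (-1) ^ m *
      (((n : ℂ) - m * Complex.I)⁻¹ ^ 2 + ((n : ℂ) + m * Complex.I)⁻¹ ^ 2)) atTop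
      (𝓝 (Real.pi ^ 2 * Complex.cosh (n * Real.pi) / Complex.sinh (n * Real.pi) ^ 2)) := by
  have hn0 : (n : ℂ) ≠ 0 := by exact_mod_cast (by omega : n ≠ 0)
  have hz : 0 < ((n : ℂ) * Complex.I).im := by simp; omega
  have h := (((hasSum_alternating_inv_sq hz).mul_left (Complex.I ^ 2)).tendsto_sum_nat).const_add
    ((n : ℂ)⁻¹ ^ 2)
  convert! h using 2 with M
  · congr 1
    rw [sum_Icc_eq_sum_range_succ]
    refine Finset.sum_congr rfl fun k _ => ?_
    rw [inv_sub_mul_I, inv_add_mul_I]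
    push_cast
    ring
  · have hs := sin_pi_mul_ne_zero_of_im_pos hz
    rw [← mul_assoc, Complex.sin_mul_I, mul_comm (Real.pi : ℂ)] at hs
    rw [← mul_assoc, Complex.cos_mul_I, Complex.sin_mul_I, mul_comm (Real.pi : ℂ)]
    have hs' := left_ne_zero_of_mul hs
    rw [mul_pow, mul_inv, mul_pow, inv_pow, inv_pow, Complex.I_sq]
    field_simp
    ring

/-- Dominated convergence for sums over the growing intervals `[1, N]`. -/
theorem tendsto_sum_Icc_of_dominated {f : ℕ → ℕ → ℂ} {g : ℕ → ℂ} {b : ℕ → ℝ} (hb : Summable b)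
    (hb0 : ∀ n, 0 ≤ b n) (hg : g 0 = 0)
    (hlim : ∀ n, 1 ≤ n → Tendsto (fun N => f N n) atTop (𝓝 (g n)))
    (hbound : ∀ N n, 1 ≤ n → n ≤ N → ‖f N n‖ ≤ b n) :
    Tendsto (fun N => ∑ n ∈ Finset.Icc 1 N, f N n) atTop (𝓝 (∑' n, g n)) := by
  have h := tendsto_tsum_of_dominated_convergence (𝓕 := atTop)
    (f := fun N n => if n ∈ Finset.Icc 1 N then f N n else 0) (g := g) hb ?_ ?_
  · refine h.congr fun N => ?_
    rw [tsum_eq_sum (s := Finset.Icc 1 N) fun n hn => if_neg hn]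
    exact Finset.sum_congr rfl fun n hn => if_pos hn
  · intro n
    rcases Nat.eq_zero_or_pos n with rfl | hn
    · simp [hg]
    · refine (hlim n hn).congr' ?_
      filter_upwards [eventually_ge_atTop n] with N hN
      rw [if_pos (Finset.mem_Icc.2 ⟨hn, hN⟩)]
  · refine Eventually.of_forall fun N n => ?_
    split_ifs with hn
    · exact hbound N n (Finset.mem_Icc.1 hn).1 (Finset.mem_Icc.1 hn).2
    · rw [norm_zero]
      exact hb0 n

/-! ### Bounds and limits of the pole coefficients -/

theorem harmonic_nonneg (n : ℕ) : 0 ≤ (harmonic n : ℝ) := by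
  rw [harmonic_eq_sum_range_inv]
  positivity

theorem harmonic_add_sub (a n : ℕ) :
    (harmonic (a + n) : ℝ) - harmonic a = ∑ k ∈ Finset.range n, ((a : ℝ) + k + 1)⁻¹ := by
  simp_rw [harmonic_eq_sum_range_inv, Finset.sum_range_add]
  push_cast
  ring

theorem harmonic_add_sub_nonneg (a n : ℕ) : 0 ≤ (harmonic (a + n) : ℝ) - harmonic a := by
  rw [harmonic_add_sub]
  positivity

theorem harmonic_add_sub_le (a n : ℕ) : (harmonic (a + n) : ℝ) - harmonic a ≤ harmonic n := by
  rw [harmonic_add_sub, harmonic_eq_sum_range_inv]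
  refine Finset.sum_le_sum fun k _ => inv_anti₀ (by positivity) ?_
  linarith [(a.cast_nonneg : (0 : ℝ) ≤ a)]

theorem tendsto_harmonic_add_sub (n : ℕ) :
    Tendsto (fun N : ℕ => (harmonic (N + n) : ℝ) - harmonic N) atTop (𝓝 0) := by
  simp_rw [harmonic_add_sub]
  rw [← Finset.sum_const_zero (s := Finset.range n)]
  refine tendsto_finsetSum _ fun k _ => ?_
  refine tendsto_inv_atTop_zero.comp ?_
  simp_rw [add_assoc]
  exact tendsto_atTop_add_const_right _ _ tendsto_natCast_atTop_atTop

theorem inv_le_harmonic {n : ℕ} (hn : 1 ≤ n) : (n : ℝ)⁻¹ ≤ harmonic n := by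
  obtain ⟨m, rfl⟩ : ∃ m, n = m + 1 := ⟨n - 1, by omega⟩
  rw [harmonic_succ]
  push_cast
  linarith [harmonic_nonneg m]

/-- The large harmonic numbers are grouped into increments H_(a+n) - H_a, which lie in [0, H_n] and
vanish as a → ∞. This gives both the limit H_n and a bound uniform in N. -/
theorem poleCoeff_eq {N n : ℕ} (h : n ≤ N) :
    poleCoeff N n = ((harmonic n + 2 * ((harmonic (N - n + n) : ℝ) - harmonic (N - n)) +
      ((harmonic (N + n) : ℝ) - harmonic N) : ℝ) : ℂ) := by
  rw [poleCoeff, Nat.sub_add_cancel h]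
  push_cast
  ring

theorem negPoleCoeff_eq (N n : ℕ) :
    negPoleCoeff N n = ((harmonic n - (n : ℝ)⁻¹ - ((harmonic (N + n) : ℝ) - harmonic N) : ℝ) : ℂ) := by
  rw [negPoleCoeff]
  push_cast
  ring

theorem norm_poleCoeff_le {N n : ℕ} (h : n ≤ N) : ‖poleCoeff N n‖ ≤ 4 * harmonic n := by
  rw [poleCoeff_eq h, Complex.norm_real, Real.norm_eq_abs, abs_le]
  have := harmonic_nonneg n
  have := harmonic_add_sub_nonneg (N - n) n
  have := harmonic_add_sub_nonneg N n
  have := harmonic_add_sub_le (N - n) n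
  have := harmonic_add_sub_le N n
  constructor <;> linarith

theorem norm_negPoleCoeff_le (N : ℕ) {n : ℕ} (hn : 1 ≤ n) : ‖negPoleCoeff N n‖ ≤ harmonic n := by
  rw [negPoleCoeff_eq, Complex.norm_real, Real.norm_eq_abs, abs_le]
  have := inv_le_harmonic hn
  have : (0 : ℝ) ≤ (n : ℝ)⁻¹ := by positivity
  have := harmonic_add_sub_nonneg N n
  have := harmonic_add_sub_le N n
  constructor <;> linarith

theorem tendsto_poleCoeff (n : ℕ) :
    Tendsto (fun N => poleCoeff N n) atTop (𝓝 (harmonic n : ℂ)) := by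
  have h1 : Tendsto (fun N : ℕ => (harmonic (N - n + n) : ℝ) - harmonic (N - n)) atTop (𝓝 0) :=
    (tendsto_harmonic_add_sub n).comp (tendsto_sub_atTop_nat n)
  have h2 := ((h1.const_mul 2).const_add (harmonic n : ℝ)).add (tendsto_harmonic_add_sub n)
  rw [mul_zero, add_zero, add_zero] at h2
  have h3 := (Complex.continuous_ofReal.tendsto _).comp h2
  rw [Complex.ofReal_ratCast] at h3
  refine h3.congr' ?_
  filter_upwards [eventually_ge_atTop n] with N hN
  rw [poleCoeff_eq hN, Function.comp_apply]

theorem tendsto_negPoleCoeff (n : ℕ) :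
    Tendsto (fun N => negPoleCoeff N n) atTop (𝓝 ((harmonic n : ℂ) - (n : ℂ)⁻¹)) := by
  have h2 := (tendsto_harmonic_add_sub n).const_sub ((harmonic n : ℝ) - (n : ℝ)⁻¹)
  rw [sub_zero] at h2
  have h3 := (Complex.continuous_ofReal.tendsto _).comp h2
  push_cast at h3
  refine h3.congr fun N => ?_
  rw [negPoleCoeff_eq, Function.comp_apply]

theorem harmonic_le_sqrt {n : ℕ} (hn : 1 ≤ n) : (harmonic n : ℝ) ≤ 3 * √n := by
  have h1 := harmonic_le_one_add_log n
  have h2 : Real.log n ≤ (n : ℝ) ^ (1 / 2 : ℝ) / (1 / 2) :=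
    Real.log_le_rpow_div n.cast_nonneg (by norm_num)
  rw [← Real.sqrt_eq_rpow] at h2
  have h3 : 1 ≤ √(n : ℝ) := Real.one_le_sqrt.2 (by exact_mod_cast hn)
  linarith

theorem summable_inv_sq_mul_sqrt : Summable fun n : ℕ => (n : ℝ)⁻¹ ^ 2 * √n := by
  have h : Summable fun n : ℕ => ((n : ℝ) ^ (3 / 2 : ℝ))⁻¹ :=
    Real.summable_nat_rpow_inv.2 (by norm_num)
  refine h.congr fun n => ?_
  rcases Nat.eq_zero_or_pos n with rfl | hn
  · simp
  · have hn' : (0 : ℝ) < n := by exact_mod_cast hn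
    rw [Real.sqrt_eq_rpow, ← Real.rpow_neg hn'.le, ← Real.rpow_natCast, Real.inv_rpow hn'.le,
      ← Real.rpow_neg hn'.le, ← Real.rpow_add hn']
    norm_num

theorem one_le_sqrt_natCast {n : ℕ} (hn : 1 ≤ n) : 1 ≤ √(n : ℝ) :=
  Real.one_le_sqrt.2 (by exact_mod_cast hn)

theorem inv_natCast_pow_le {n p : ℕ} (hn : 1 ≤ n) (hp : 1 ≤ p) : (n : ℝ)⁻¹ ^ p ≤ (n : ℝ)⁻¹ :=
  pow_le_of_le_one (by positivity) (inv_le_one_of_one_le₀ (by exact_mod_cast hn)) (by omega)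

theorem natCast_le_norm_sub {z : ℂ} (hz : z.re = 0) (n : ℕ) : (n : ℝ) ≤ ‖(n : ℂ) - z‖ := by
  refine le_trans ?_ (Complex.re_le_norm _)
  simp [hz]

theorem natCast_le_norm_add {z : ℂ} (hz : z.re = 0) (n : ℕ) : (n : ℝ) ≤ ‖(n : ℂ) + z‖ := by
  refine le_trans ?_ (Complex.re_le_norm _)
  simp [hz]

/-- On the imaginary axis |n ± z| ≥ n, so the bound is uniform in z. One factor 1/n comes from
n^(-p), the other from the pole. -/
theorem norm_polePart_le (a b : ℂ) {p n : ℕ} {z : ℂ} (hp : 1 ≤ p) (hn : 1 ≤ n) (hz : z.re = 0) :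
    ‖polePart a b p n z‖ ≤ (n : ℝ)⁻¹ ^ 2 * (1 + p + ‖a‖ + ‖b‖) := by
  have hn0 : (0 : ℝ) < n := by exact_mod_cast hn
  have h1 : ‖((n : ℂ) - z)⁻¹‖ ≤ (n : ℝ)⁻¹ := by
    rw [norm_inv]
    exact inv_anti₀ hn0 (natCast_le_norm_sub hz n)
  have h2 : ‖((n : ℂ) + z)⁻¹‖ ≤ (n : ℝ)⁻¹ := by
    rw [norm_inv]
    exact inv_anti₀ hn0 (natCast_le_norm_add hz n)
  have h3 : (n : ℝ)⁻¹ ≤ 1 := inv_le_one_of_one_le₀ (by exact_mod_cast hn)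
  have h4 : ‖((n : ℂ) - z)⁻¹ ^ 2 + (p * (n : ℂ)⁻¹ - a) * ((n : ℂ) - z)⁻¹ +
      (-1) ^ p * b * ((n : ℂ) + z)⁻¹‖ ≤
      (n : ℝ)⁻¹ ^ 2 + (p * 1 + ‖a‖) * (n : ℝ)⁻¹ + ‖b‖ * (n : ℝ)⁻¹ := by
    refine (norm_add_le _ _).trans (add_le_add ((norm_add_le _ _).trans (add_le_add ?_ ?_)) ?_)
    · rw [norm_pow]
      gcongr
    · rw [norm_mul]
      gcongr
      refine (norm_sub_le _ _).trans ?_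
      rw [norm_mul, norm_inv, Complex.norm_natCast, Complex.norm_natCast]
      gcongr
    · rw [norm_mul, norm_mul, norm_pow, norm_neg, norm_one, one_pow, one_mul]
      gcongr
  rw [polePart, norm_mul, norm_pow, norm_inv, Complex.norm_natCast]
  calc (n : ℝ)⁻¹ ^ p * _
      ≤ (n : ℝ)⁻¹ * ((n : ℝ)⁻¹ ^ 2 + (p * 1 + ‖a‖) * (n : ℝ)⁻¹ + ‖b‖ * (n : ℝ)⁻¹) := by
        gcongr
        exact inv_natCast_pow_le hn hp
    _ = (n : ℝ)⁻¹ ^ 2 * ((n : ℝ)⁻¹ + p + ‖a‖ + ‖b‖) := by ring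
    _ ≤ _ := by gcongr

/-- From H_n ≤ 3√n the bracket is at most (1 + p + 5 · 3)√n. The resulting n^(-3/2) is the
dominating series throughout. -/
theorem norm_polePart_le_of_le {a b : ℂ} {p n : ℕ} {z : ℂ} (hp : 1 ≤ p) (hn : 1 ≤ n)
    (hz : z.re = 0) (ha : ‖a‖ ≤ 4 * harmonic n) (hb : ‖b‖ ≤ harmonic n) :
    ‖polePart a b p n z‖ ≤ (p + 16) * ((n : ℝ)⁻¹ ^ 2 * √n) := by
  refine (norm_polePart_le a b hp hn hz).trans ?_
  rw [mul_left_comm]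
  have h1 := harmonic_le_sqrt hn
  have h2 := one_le_sqrt_natCast hn
  have h3 : (p : ℝ) * 1 ≤ p * √n := by gcongr
  gcongr
  linarith

theorem norm_harmonic (n : ℕ) : ‖(harmonic n : ℂ)‖ = harmonic n := by
  rw [← Complex.ofReal_ratCast, Complex.norm_real, Real.norm_of_nonneg (harmonic_nonneg n)]

theorem norm_harmonic_sub_inv_le {n : ℕ} (hn : 1 ≤ n) :
    ‖(harmonic n : ℂ) - (n : ℂ)⁻¹‖ ≤ harmonic n := by
  rw [← Complex.ofReal_ratCast, ← Complex.ofReal_natCast, ← Complex.ofReal_inv,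
    ← Complex.ofReal_sub, Complex.norm_real, Real.norm_of_nonneg (sub_nonneg.2 (inv_le_harmonic hn))]
  have : (0 : ℝ) ≤ (n : ℝ)⁻¹ := by positivity
  linarith

theorem polePart_zero_left (a b : ℂ) {p : ℕ} (hp : 1 ≤ p) (z : ℂ) : polePart a b p 0 z = 0 := by
  simp [polePart, zero_pow (by omega : p ≠ 0)]

theorem summable_polePart {p : ℕ} (hp : 1 ≤ p) {z : ℂ} (hz : z.re = 0) :
    Summable fun n : ℕ => polePart (harmonic n) (harmonic n - (n : ℂ)⁻¹) p n z := by
  refine Summable.of_norm_bounded (summable_inv_sq_mul_sqrt.mul_left (p + 16 : ℝ)) fun n => ?_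
  rcases Nat.eq_zero_or_pos n with rfl | hn
  · rw [polePart_zero_left _ _ hp]
    simp
  · refine norm_polePart_le_of_le hp hn hz ?_ (norm_harmonic_sub_inv_le hn)
    rw [norm_harmonic]
    linarith [harmonic_nonneg n]

theorem tendsto_sum_polePart {p : ℕ} (hp : 1 ≤ p) {z : ℂ} (hz : z.re = 0) :
    Tendsto (fun N => ∑ n ∈ Finset.Icc 1 N, polePart (poleCoeff N n) (negPoleCoeff N n) p n z) atTop
      (𝓝 (∑' n : ℕ, polePart (harmonic n) (harmonic n - (n : ℂ)⁻¹) p n z)) := by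
  refine tendsto_sum_Icc_of_dominated (summable_inv_sq_mul_sqrt.mul_left (p + 16 : ℝ))
    (fun n => by positivity) (polePart_zero_left _ _ hp _) (fun n hn => ?_) (fun N n hn hnN => ?_)
  · exact (((((tendsto_poleCoeff n).const_sub _).mul_const _).const_add _).add
      (((tendsto_negPoleCoeff n).const_mul _).mul_const _)).const_mul _
  · exact norm_polePart_le_of_le hp hn hz (norm_poleCoeff_le hnN) (norm_negPoleCoeff_le N hn)

/-! ### The limit N → ∞: zeta values and the expansion on the imaginary axis -/

theorem hasSum_succ_inv_pow {k : ℕ} (hk : 2 ≤ k) :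
    HasSum (fun n : ℕ => ((n : ℂ) + 1)⁻¹ ^ k) (riemannZeta k) := by
  have h1 : Summable fun n : ℕ => 1 / (n : ℂ) ^ k :=
    Summable.of_norm (by simpa using Real.summable_nat_pow_inv.2 (by omega : 1 < k))
  have h2 := h1.hasSum
  rw [← zeta_nat_eq_tsum_of_gt_one (by omega : 1 < k), ← hasSum_nat_add_iff' 1] at h2
  simpa [zero_pow (by omega : k ≠ 0)] using h2

theorem tendsto_sum_inv_pow {k : ℕ} (hk : 2 ≤ k) :
    Tendsto (fun N : ℕ => ∑ n ∈ Finset.Icc 1 N, ((n : ℂ)⁻¹) ^ k) atTop (𝓝 (riemannZeta k)) := by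
  refine (hasSum_succ_inv_pow hk).tendsto_sum_nat.congr fun N => ?_
  rw [sum_Icc_eq_sum_range_succ]
  push_cast
  rfl

theorem tendsto_sum_alternating_inv_pow {k : ℕ} (hk : 2 ≤ k) :
    Tendsto (fun N : ℕ => ∑ n ∈ Finset.Icc 1 N, (-1) ^ n * ((n : ℂ)⁻¹) ^ k) atTop
      (𝓝 (-((1 - 2 * 2⁻¹ ^ k) * riemannZeta k))) := by
  have h := hasSum_alternating_of_odd (hasSum_succ_inv_pow hk)
    (((hasSum_succ_inv_pow hk).mul_left (2⁻¹ ^ k)).congr_fun fun j => ?_)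
  · rw [show -((1 - 2 * 2⁻¹ ^ k) * riemannZeta k) =
      2 * (2⁻¹ ^ k * riemannZeta k) - riemannZeta k by ring]
    refine h.tendsto_sum_nat.congr fun N => ?_
    rw [sum_Icc_eq_sum_range_succ]
    push_cast
    rfl
  · rw [← mul_pow, ← mul_inv]
    push_cast
    congr 2
    ring

/-- The power series of `π x cot (π x)`. -/
noncomputable def cotLimPS : PowerSeries ℂ :=
  PowerSeries.mk fun j => if j = 0 then 1 else if j = 1 then 0 else -((1 + (-1) ^ j) * riemannZeta j)

/-- The power series of `x (ψ(-x) + γ)`. -/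
noncomputable def digammaLimPS : PowerSeries ℂ :=
  PowerSeries.mk fun j => if j = 0 then 1 else if j = 1 then 0 else -riemannZeta j

theorem coeff_succ_cotPS (N j : ℕ) :
    PowerSeries.coeff (j + 1) (cotPS N) =
      -((1 + (-1) ^ (j + 1)) * ∑ n ∈ Finset.Icc 1 N, (n : ℂ)⁻¹ ^ (j + 1)) := by
  rw [cotPS, map_sub, PowerSeries.coeff_one, if_neg (by omega), PowerSeries.coeff_succ_X_mul,
    map_sum, zero_sub, Finset.mul_sum]
  congr 1
  refine Finset.sum_congr rfl fun n _ => ?_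
  rw [map_sub, PowerSeries.coeff_mk, PowerSeries.coeff_mk]
  ring

theorem coeff_succ_succ_digammaPS (N j : ℕ) :
    PowerSeries.coeff (j + 2) (digammaPS N) = -∑ n ∈ Finset.Icc 1 N, (n : ℂ)⁻¹ ^ (j + 2) := by
  rw [digammaPS, map_sub, PowerSeries.coeff_one, if_neg (by omega), PowerSeries.coeff_succ_X_mul,
    map_sum, zero_sub]
  congr 1
  refine Finset.sum_congr rfl fun n _ => ?_
  rw [map_sub, PowerSeries.coeff_mk, PowerSeries.algebraMap_apply, PowerSeries.coeff_C,
    if_neg (by omega), sub_zero]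

theorem tendsto_coeff_cotPS (j : ℕ) :
    Tendsto (fun N => PowerSeries.coeff j (cotPS N)) atTop (𝓝 (PowerSeries.coeff j cotLimPS)) := by
  rw [cotLimPS, PowerSeries.coeff_mk]
  rcases j with _ | _ | j
  · simp [cotPS]
  · simp [coeff_succ_cotPS]
  · rw [if_neg (by omega), if_neg (by omega)]
    simp_rw [coeff_succ_cotPS]
    exact ((tendsto_sum_inv_pow (by omega)).const_mul _).neg

theorem tendsto_coeff_digammaPS (j : ℕ) :
    Tendsto (fun N => PowerSeries.coeff j (digammaPS N)) atTop
      (𝓝 (PowerSeries.coeff j digammaLimPS)) := by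
  rw [digammaLimPS, PowerSeries.coeff_mk]
  rcases j with _ | _ | j
  · simp [digammaPS]
  · simp [digammaPS, PowerSeries.coeff_one, PowerSeries.coeff_succ_X_mul]
  · rw [if_neg (by omega), if_neg (by omega)]
    simp_rw [coeff_succ_succ_digammaPS]
    exact (tendsto_sum_inv_pow (by omega)).neg

theorem tendsto_coeff_cotPS_mul_digammaPS (j : ℕ) :
    Tendsto (fun N => PowerSeries.coeff j (cotPS N * digammaPS N)) atTop
      (𝓝 (PowerSeries.coeff j (cotLimPS * digammaLimPS))) := by
  simp_rw [PowerSeries.coeff_mul]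
  exact tendsto_finsetSum _ fun x _ => (tendsto_coeff_cotPS x.1).mul (tendsto_coeff_digammaPS x.2)

/-- Two evaluations of the limit of one truncated Taylor coefficient. The right side later serves as
the term m = 0 of the sum over the points mi. -/
theorem coeff_cotLimPS_mul_digammaLimPS {p : ℕ} (hp : 1 ≤ p) :
    PowerSeries.coeff (p + 2) (cotLimPS * digammaLimPS) =
      ∑' n : ℕ, polePart (harmonic n) (harmonic n - (n : ℂ)⁻¹) p n 0 := by
  refine tendsto_nhds_unique (tendsto_coeff_cotPS_mul_digammaPS (p + 2)) ?_
  simp_rw [coeff_cotPS_mul_digammaPS]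
  exact tendsto_sum_polePart hp Complex.zero_re

theorem tendsto_mul_cot {z : ℂ} (hz : z ∈ Complex.integerComplement) :
    Tendsto (fun N : ℕ => 1 - z * ∑ n ∈ Finset.Icc 1 N, (((n : ℂ) - z)⁻¹ - ((n : ℂ) + z)⁻¹)) atTop
      (𝓝 (z * (Real.pi * Complex.cot (Real.pi * z)))) := by
  have h := ((tendsto_logDeriv_euler_cot_sub hz).const_mul z).const_add 1
  have hz0 := Complex.integerComplement.ne_zero hz
  convert! h using 2 with N
  · rw [sum_Icc_eq_sum_range_succ, sub_eq_add_neg, ← mul_neg, ← Finset.sum_neg_distrib]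
    congr 2
    refine Finset.sum_congr rfl fun k _ => ?_
    push_cast
    rw [cotTerm, one_div, one_div, ← neg_sub z, inv_neg, add_comm z]
    ring
  · field_simp
    ring

theorem tendsto_mul_digamma {z : ℂ} (hz : z.re = 0) (hz0 : z ≠ 0) :
    Tendsto (fun N : ℕ => 1 - z * ∑ n ∈ Finset.Icc 1 N, (((n : ℂ) - z)⁻¹ - (n : ℂ)⁻¹)) atTop
      (𝓝 (z * (Complex.digamma (-z) + Real.eulerMascheroniConstant))) := by
  have h1 := hasSum_digamma_add_one (w := -z) (by simp [hz])
  have h := (h1.tendsto_sum_nat.const_mul z).const_add 1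
  have h2 : ∀ m : ℕ, -z ≠ -m := by
    intro m hm
    rw [neg_inj] at hm
    rw [hm] at hz hz0
    simp at hz
    simp [hz] at hz0
  convert! h using 2 with N
  · rw [sum_Icc_eq_sum_range_succ, sub_eq_add_neg, ← mul_neg, ← Finset.sum_neg_distrib]
    congr 2
    refine Finset.sum_congr rfl fun k _ => ?_
    push_cast
    ring
  -- The shift ψ(1 - z) = ψ(-z) - 1/z absorbs the constant 1.
  · rw [Complex.digamma_apply_add_one _ h2, inv_neg]
    field_simp
    ring

theorem residue_sum {p : ℕ} (hp : 1 ≤ p) {z : ℂ} (hz : z.re = 0) (hz0 : z ≠ 0) :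
    z * (Real.pi * Complex.cot (Real.pi * z)) *
        (z * (Complex.digamma (-z) + Real.eulerMascheroniConstant)) =
      ∑ j ∈ Finset.range (p + 2), PowerSeries.coeff j (cotLimPS * digammaLimPS) * z ^ j +
        z ^ (p + 2) * ∑' n : ℕ, polePart (harmonic n) (harmonic n - (n : ℂ)⁻¹) p n z := by
  have hzi : z ∈ Complex.integerComplement := by
    rintro ⟨m, hm⟩
    rw [← hm] at hz hz0
    simp at hz
    simp [hz] at hz0
  have h1 : ∀ n : ℕ, 1 ≤ n → (n : ℂ) - z ≠ 0 := fun n hn => by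
    have h := natCast_le_norm_sub hz n
    rw [← norm_pos_iff]
    exact lt_of_lt_of_le (by exact_mod_cast hn) h
  have h2 : ∀ n : ℕ, 1 ≤ n → (n : ℂ) + z ≠ 0 := fun n hn => by
    have h := natCast_le_norm_add hz n
    rw [← norm_pos_iff]
    exact lt_of_lt_of_le (by exact_mod_cast hn) h
  refine tendsto_nhds_unique ((tendsto_mul_cot hzi).mul (tendsto_mul_digamma hz hz0)) ?_
  simp_rw [truncated_residue_sum _ p h1 h2]
  exact (tendsto_finsetSum _ fun j _ => (tendsto_coeff_cotPS_mul_digammaPS j).mul_const _).add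
    ((tendsto_sum_polePart hp hz).const_mul _)

/-! ### Summation over the imaginary poles and the limit M → ∞ -/

theorem alternating_sum_mem_Icc {a : ℕ → ℝ} (ha : Antitone a) (ha0 : ∀ k, 0 ≤ a k) (M : ℕ) :
    0 ≤ ∑ k ∈ Finset.range M, (-1) ^ k * a k ∧ ∑ k ∈ Finset.range M, (-1) ^ k * a k ≤ a 0 := by
  induction M generalizing a with
  | zero => simpa using ha0 0
  | succ M ih =>
    have h := ih (a := fun k => a (k + 1)) (fun i j hij => ha (by omega)) fun k => ha0 _
    have h1 : ∑ k ∈ Finset.range M, (-1) ^ (k + 1) * a (k + 1) =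
        -∑ k ∈ Finset.range M, (-1) ^ k * a (k + 1) := by
      rw [← Finset.sum_neg_distrib]
      exact Finset.sum_congr rfl fun k _ => by ring
    rw [Finset.sum_range_succ', h1]
    have h2 := ha (zero_le_one' ℕ)
    simp only [zero_add] at h
    constructor <;> linarith [h.1, h.2]

/-- The partial fractions of `π / sinh (π n)` truncated to the poles `m * I` with `|m| ≤ M`. -/
noncomputable def cschSum (M n : ℕ) : ℂ :=
  (n : ℂ)⁻¹ + ∑ m ∈ Finset.Icc 1 M, (-1) ^ m *
    (((n : ℂ) - m * Complex.I)⁻¹ + ((n : ℂ) + m * Complex.I)⁻¹)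

/-- The partial fractions of `π² cosh (π n) / sinh (π n) ^ 2` truncated to the poles `m * I` with
`|m| ≤ M`. -/
noncomputable def cschDerivSum (M n : ℕ) : ℂ :=
  (n : ℂ)⁻¹ ^ 2 + ∑ m ∈ Finset.Icc 1 M, (-1) ^ m *
    (((n : ℂ) - m * Complex.I)⁻¹ ^ 2 + ((n : ℂ) + m * Complex.I)⁻¹ ^ 2)

theorem sub_mul_add_mul_I (n m : ℂ) :
    (n - m * Complex.I) * (n + m * Complex.I) = n ^ 2 + m ^ 2 := by
  linear_combination (-m ^ 2) * Complex.I_sq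

theorem inv_sub_add_inv_add_mul_I {n m : ℕ} (hn : 1 ≤ n) :
    ((n : ℂ) - m * Complex.I)⁻¹ + ((n : ℂ) + m * Complex.I)⁻¹ =
      ((2 * (n : ℝ) * ((n : ℝ) ^ 2 + (m : ℝ) ^ 2)⁻¹ : ℝ) : ℂ) := by
  have h : (n : ℂ) ^ 2 + (m : ℂ) ^ 2 ≠ 0 := by
    exact_mod_cast (by positivity : n ^ 2 + m ^ 2 ≠ 0)
  have h2 := h
  rw [← sub_mul_add_mul_I] at h2
  have h3 := left_ne_zero_of_mul h2
  have h4 := right_ne_zero_of_mul h2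
  push_cast
  rw [← sub_mul_add_mul_I]
  field_simp
  ring

/-- The terms 2n/(n² + m²) decrease in m, so the alternating sum is at most its first term. Absolute
values would only give O(1), too weak for p = 1. -/
theorem norm_cschSum_le {M n : ℕ} (hn : 1 ≤ n) : ‖cschSum M n‖ ≤ 3 * (n : ℝ)⁻¹ := by
  have hn0 : (0 : ℝ) < n := by exact_mod_cast hn
  set a : ℕ → ℝ := fun k => 2 * (n : ℝ) * ((n : ℝ) ^ 2 + ((k + 1 : ℕ) : ℝ) ^ 2)⁻¹ with ha
  have h := alternating_sum_mem_Icc (a := a) (fun i j hij => by simp only [ha]; gcongr)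
    (fun k => by positivity) M
  have h0 : a 0 ≤ 2 * (n : ℝ)⁻¹ := by
    have : a 0 ≤ 2 * (n : ℝ) * ((n : ℝ) ^ 2)⁻¹ := by
      simp only [ha]
      gcongr
      simp
    refine this.trans (le_of_eq ?_)
    field_simp
  have e : cschSum M n = (((n : ℝ)⁻¹ - ∑ k ∈ Finset.range M, (-1) ^ k * a k : ℝ) : ℂ) := by
    rw [cschSum, sum_Icc_eq_sum_range_succ, sub_eq_add_neg, ← Finset.sum_neg_distrib]
    push_cast
    congr 1
    refine Finset.sum_congr rfl fun k _ => ?_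
    have := inv_sub_add_inv_add_mul_I (m := k + 1) hn
    push_cast at this
    rw [this]
    simp only [ha]
    push_cast
    ring
  have h1 : (0 : ℝ) < (n : ℝ)⁻¹ := by positivity
  rw [e, Complex.norm_real, Real.norm_eq_abs, abs_le]
  constructor <;> linarith [h.1, h.2]

/-- With n = t² and m = s² this is s³t ≤ max(s, t)⁴ ≤ s⁴ + t⁴. The exponents are chosen so that
m^(-3/2) is summable and n^(-1/2), times n^(-p), is too. -/
theorem inv_sq_add_sq_le {n m : ℕ} (hn : 1 ≤ n) (hm : 1 ≤ m) :
    ((n : ℝ) ^ 2 + (m : ℝ) ^ 2)⁻¹ ≤ (n : ℝ)⁻¹ * √n * ((m : ℝ)⁻¹ ^ 2 * √m) := by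
  have hn0 : (0 : ℝ) < n := by exact_mod_cast hn
  have hm0 : (0 : ℝ) < m := by exact_mod_cast hm
  obtain ⟨t, ht, htn⟩ : ∃ t : ℝ, 0 < t ∧ (n : ℝ) = t ^ 2 :=
    ⟨√n, Real.sqrt_pos.2 hn0, (Real.sq_sqrt hn0.le).symm⟩
  obtain ⟨s, hs, hsm⟩ : ∃ s : ℝ, 0 < s ∧ (m : ℝ) = s ^ 2 :=
    ⟨√m, Real.sqrt_pos.2 hm0, (Real.sq_sqrt hm0.le).symm⟩
  rw [htn, hsm, Real.sqrt_sq ht.le, Real.sqrt_sq hs.le]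
  have e : (t ^ 2)⁻¹ * t * ((s ^ 2)⁻¹ ^ 2 * s) = (s ^ 3 * t)⁻¹ := by
    field_simp
  rw [e]
  refine inv_anti₀ (by positivity) ?_
  rcases le_total t s with h | h
  · calc s ^ 3 * t ≤ s ^ 3 * s := by gcongr
      _ ≤ _ := by nlinarith [sq_nonneg (t ^ 2)]
  · calc s ^ 3 * t ≤ t ^ 3 * t := by gcongr
      _ ≤ _ := by nlinarith [sq_nonneg (s ^ 2)]

theorem norm_natCast_sub_mul_I_sq (n m : ℕ) :
    ‖(n : ℂ) - m * Complex.I‖ ^ 2 = (n : ℝ) ^ 2 + (m : ℝ) ^ 2 := by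
  rw [Complex.sq_norm, Complex.normSq_apply]
  simp
  ring

theorem norm_natCast_add_mul_I_sq (n m : ℕ) :
    ‖(n : ℂ) + m * Complex.I‖ ^ 2 = (n : ℝ) ^ 2 + (m : ℝ) ^ 2 := by
  rw [Complex.sq_norm, Complex.normSq_apply]
  simp
  ring

theorem exists_norm_cschDerivSum_le :
    ∃ K : ℝ, 0 ≤ K ∧ ∀ M n : ℕ, 1 ≤ n → ‖cschDerivSum M n‖ ≤ K * ((n : ℝ)⁻¹ * √n) := by
  refine ⟨1 + 2 * ∑' m : ℕ, (m : ℝ)⁻¹ ^ 2 * √m, ?_, fun M n hn => ?_⟩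
  · have : 0 ≤ ∑' m : ℕ, (m : ℝ)⁻¹ ^ 2 * √m := tsum_nonneg fun m => by positivity
    positivity
  · have h1 : ∀ m ∈ Finset.Icc 1 M, ‖(-1 : ℂ) ^ m *
        (((n : ℂ) - m * Complex.I)⁻¹ ^ 2 + ((n : ℂ) + m * Complex.I)⁻¹ ^ 2)‖ ≤
        2 * ((n : ℝ)⁻¹ * √n) * ((m : ℝ)⁻¹ ^ 2 * √m) := by
      intro m hm
      rw [norm_mul, norm_pow, norm_neg, norm_one, one_pow, one_mul]
      refine (norm_add_le _ _).trans ?_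
      rw [norm_pow, norm_pow, norm_inv, norm_inv, inv_pow, inv_pow, norm_natCast_sub_mul_I_sq,
        norm_natCast_add_mul_I_sq]
      have := inv_sq_add_sq_le hn (Finset.mem_Icc.1 hm).1
      linarith
    have h2 : (n : ℝ)⁻¹ ^ 2 ≤ (n : ℝ)⁻¹ * √n := by
      rw [sq]
      gcongr
      exact (inv_le_one_of_one_le₀ (by exact_mod_cast hn)).trans (one_le_sqrt_natCast hn)
    have h3 := summable_inv_sq_mul_sqrt.sum_le_tsum (Finset.Icc 1 M) fun m _ => by positivity
    refine (norm_add_le _ _).trans ?_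
    rw [add_mul, one_mul]
    refine add_le_add ?_ ((norm_sum_le_of_le _ h1).trans ?_)
    · rw [norm_pow, norm_inv, Complex.norm_natCast]
      exact h2
    · rw [← Finset.mul_sum, mul_right_comm]
      gcongr

theorem polePart_add_sum (a b : ℂ) (p n M : ℕ) :
    polePart a b p n 0 + ∑ m ∈ Finset.Icc 1 M, (-1) ^ m *
        (polePart a b p n (m * Complex.I) + polePart a b p n (-(m * Complex.I))) =
      (n : ℂ)⁻¹ ^ p * (cschDerivSum M n + (p * (n : ℂ)⁻¹ - a + (-1) ^ p * b) * cschSum M n) := by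
  have h : ∀ m : ℕ, (-1) ^ m *
      (polePart a b p n (m * Complex.I) + polePart a b p n (-(m * Complex.I))) =
      (n : ℂ)⁻¹ ^ p * ((-1) ^ m *
        (((n : ℂ) - m * Complex.I)⁻¹ ^ 2 + ((n : ℂ) + m * Complex.I)⁻¹ ^ 2)) +
      (n : ℂ)⁻¹ ^ p * (p * (n : ℂ)⁻¹ - a + (-1) ^ p * b) * ((-1) ^ m *
        (((n : ℂ) - m * Complex.I)⁻¹ + ((n : ℂ) + m * Complex.I)⁻¹)) := by
    intro m
    simp only [polePart, sub_neg_eq_add, ← sub_eq_add_neg]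
    ring
  simp_rw [h]
  rw [Finset.sum_add_distrib, ← Finset.mul_sum, ← Finset.mul_sum, cschSum, cschDerivSum, polePart,
    sub_zero, add_zero]
  ring

/-- The sum of the residues of `π cot (π s) (ψ(-s) + γ) π / (s ^ p sinh (π s))` at `n` and `-n`,
with the opposite sign. -/
noncomputable def residuePart (p n : ℕ) : ℂ :=
  (n : ℂ)⁻¹ ^ p * (Real.pi ^ 2 * Complex.cosh (n * Real.pi) / Complex.sinh (n * Real.pi) ^ 2 +
    (p * (n : ℂ)⁻¹ - harmonic n + (-1) ^ p * (harmonic n - (n : ℂ)⁻¹)) *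
      (Real.pi / Complex.sinh (n * Real.pi)))

/-- For each n the inner sum is a truncation of the partial fractions of π / sinh and its
derivative; bounds uniform in M allow dominated convergence. The constant (p + 6) · 3 combines p +
2H_n ≤ (p + 6)√n with the bound 3/n on `cschSum`. -/
theorem tendsto_tsum_polePart {p : ℕ} (hp : 1 ≤ p) :
    Tendsto (fun M : ℕ => ∑' n : ℕ, (polePart (harmonic n) (harmonic n - (n : ℂ)⁻¹) p n 0 +
      ∑ m ∈ Finset.Icc 1 M, (-1) ^ m *
        (polePart (harmonic n) (harmonic n - (n : ℂ)⁻¹) p n (m * Complex.I) +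
          polePart (harmonic n) (harmonic n - (n : ℂ)⁻¹) p n (-(m * Complex.I))))) atTop
      (𝓝 (∑' n, residuePart p n)) := by
  simp_rw [polePart_add_sum]
  obtain ⟨K, hK0, hK⟩ := exists_norm_cschDerivSum_le
  refine tendsto_tsum_of_dominated_convergence
    (summable_inv_sq_mul_sqrt.mul_left (K + (p + 6) * 3)) (fun n => ?_)
    (Eventually.of_forall fun M n => ?_)
  · rcases Nat.eq_zero_or_pos n with rfl | hn
    · simp [residuePart, zero_pow (by omega : p ≠ 0)]
    · exact ((tendsto_pi_sq_mul_cosh_div_sinh_sq hn).add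
        ((tendsto_pi_div_sinh hn).const_mul _)).const_mul _
  · rcases Nat.eq_zero_or_pos n with rfl | hn
    · simp [zero_pow (by omega : p ≠ 0)]
    · have hn0 : (0 : ℝ) < n := by exact_mod_cast hn
      have h1 := harmonic_le_sqrt hn
      have h2 := one_le_sqrt_natCast hn
      have h3 : ‖(p : ℂ) * (n : ℂ)⁻¹ - harmonic n + (-1) ^ p * (harmonic n - (n : ℂ)⁻¹)‖ ≤
          (p + 6) * √n := by
        refine (norm_add_le _ _).trans ?_
        rw [norm_mul ((-1) ^ p), norm_pow, norm_neg, norm_one, one_pow, one_mul]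
        have h4 := norm_sub_le ((p : ℂ) * (n : ℂ)⁻¹) (harmonic n)
        rw [norm_mul, norm_inv, Complex.norm_natCast, Complex.norm_natCast, norm_harmonic] at h4
        have h5 := norm_harmonic_sub_inv_le hn
        have h6 : (p : ℝ) * (n : ℝ)⁻¹ ≤ p * √n := by
          gcongr
          exact (inv_le_one_of_one_le₀ (by exact_mod_cast hn)).trans h2
        linarith
      have h4 := norm_cschSum_le (M := M) hn
      rw [norm_mul, norm_pow, norm_inv, Complex.norm_natCast]
      calc (n : ℝ)⁻¹ ^ p * _ ≤ (n : ℝ)⁻¹ *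
            (K * ((n : ℝ)⁻¹ * √n) + (p + 6) * √n * (3 * (n : ℝ)⁻¹)) := by
            gcongr
            · exact inv_natCast_pow_le hn hp
            · refine (norm_add_le _ _).trans (add_le_add (hK M n hn) ?_)
              rw [norm_mul]
              gcongr
        _ = _ := by ring

/-- The power series of `π x / sinh (π x)`. -/
noncomputable def cschLimPS : PowerSeries ℂ :=
  PowerSeries.mk fun k => if k = 0 then 1 else if k = 1 then 0 else
    (Complex.I ^ k + (-Complex.I) ^ k) * ((1 - 2 * 2⁻¹ ^ k) * riemannZeta k)

theorem tendsto_sum_alternating_inv_mul_I_pow {k : ℕ} (hk : 1 ≤ k) :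
    Tendsto (fun M : ℕ => ∑ m ∈ Finset.Icc 1 M, (-1) ^ m *
      (((m : ℂ) * Complex.I)⁻¹ ^ k + (-((m : ℂ) * Complex.I))⁻¹ ^ k)) atTop
      (𝓝 (-PowerSeries.coeff k cschLimPS)) := by
  have h : ∀ m : ℕ, (-1 : ℂ) ^ m *
      (((m : ℂ) * Complex.I)⁻¹ ^ k + (-((m : ℂ) * Complex.I))⁻¹ ^ k) =
      (Complex.I ^ k + (-Complex.I) ^ k) * ((-1) ^ m * (m : ℂ)⁻¹ ^ k) := by
    intro m
    rw [inv_neg, mul_inv, Complex.inv_I, ← mul_neg, neg_neg, mul_pow, mul_pow]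
    ring
  simp_rw [h, ← Finset.mul_sum]
  rw [cschLimPS, PowerSeries.coeff_mk, if_neg (by omega)]
  rcases eq_or_ne k 1 with rfl | hk1
  -- For k = 1 the factor I + (-I) vanishes, so no alternating harmonic series is needed.
  · simp
  · rw [if_neg hk1, ← mul_neg]
    exact (tendsto_sum_alternating_inv_pow (by omega)).const_mul _

/-- The sum of the residues of `π cot (π s) (ψ(-s) + γ) π / (s ^ p sinh (π s))` at the poles
`m * I` and `-m * I`. -/
noncomputable def imaginaryResidue (p m : ℕ) : ℂ :=
  (-1 : ℂ) ^ m *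
    (Real.pi * (Complex.cosh (m * Real.pi) / Complex.sinh (m * Real.pi)) / (m : ℂ) ^ p) *
    Complex.I ^ (p + 1) *
    (Complex.digamma (m * Complex.I) + (-1) ^ (p + 1) * Complex.digamma (-(m * Complex.I))
      + (1 + (-1) ^ (p + 1)) * Real.eulerMascheroniConstant)

theorem natCast_mul_pi_sinh_ne_zero {m : ℕ} (hm : 1 ≤ m) : Complex.sinh (m * Real.pi) ≠ 0 := by
  rw [← Complex.ofReal_natCast, ← Complex.ofReal_mul, ← Complex.ofReal_sinh, Complex.ofReal_ne_zero]
  have : (0 : ℝ) < m := by exact_mod_cast hm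
  exact (Real.sinh_pos_iff.2 (by positivity)).ne'

/-- `residue_sum` divided by z^(p+2), taken at z = mi and z = -mi, added and weighted by (-1)^m. The
signs follow from cot being odd and cot(πmi) = -i coth(πm). -/
theorem imaginaryResidue_eq {p m : ℕ} (hp : 1 ≤ p) (hm : 1 ≤ m) :
    imaginaryResidue p m = ∑ j ∈ Finset.range (p + 2),
      PowerSeries.coeff j (cotLimPS * digammaLimPS) * ((-1) ^ m *
        (((m : ℂ) * Complex.I)⁻¹ ^ (p + 2 - j) + (-((m : ℂ) * Complex.I))⁻¹ ^ (p + 2 - j))) +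
      ∑' n : ℕ, (-1) ^ m *
        (polePart (harmonic n) (harmonic n - (n : ℂ)⁻¹) p n (m * Complex.I) +
          polePart (harmonic n) (harmonic n - (n : ℂ)⁻¹) p n (-(m * Complex.I))) := by
  have hm0 : (m : ℂ) ≠ 0 := by exact_mod_cast (by omega : m ≠ 0)
  have hre : ((m : ℂ) * Complex.I).re = 0 := by simp
  have hre' : (-((m : ℂ) * Complex.I)).re = 0 := by simp
  have hz : (m : ℂ) * Complex.I ≠ 0 := mul_ne_zero hm0 Complex.I_ne_zero
  have aux : ∀ z : ℂ, z.re = 0 → z ≠ 0 →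
      Real.pi * Complex.cot (Real.pi * z) *
        (Complex.digamma (-z) + Real.eulerMascheroniConstant) * z⁻¹ ^ p =
      ∑ j ∈ Finset.range (p + 2), PowerSeries.coeff j (cotLimPS * digammaLimPS) *
        z⁻¹ ^ (p + 2 - j) +
      ∑' n : ℕ, polePart (harmonic n) (harmonic n - (n : ℂ)⁻¹) p n z := by
    intro z hz hz0
    have h := congrArg (· * z⁻¹ ^ (p + 2)) (residue_sum hp hz hz0)
    simp only [add_mul] at h
    have e1 : ∀ j ∈ Finset.range (p + 2), PowerSeries.coeff j (cotLimPS * digammaLimPS) *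
        z⁻¹ ^ (p + 2 - j) = PowerSeries.coeff j (cotLimPS * digammaLimPS) * z ^ j *
          z⁻¹ ^ (p + 2) := by
      intro j hj
      have hj' := (Finset.mem_range.1 hj).le
      rw [mul_assoc, ← Nat.sub_add_cancel hj', pow_add, Nat.sub_add_cancel hj']
      have : z ^ j * z⁻¹ ^ j = 1 := by rw [← mul_pow, mul_inv_cancel₀ hz0, one_pow]
      linear_combination (-PowerSeries.coeff j (cotLimPS * digammaLimPS) * z⁻¹ ^ (p + 2 - j)) * this
    rw [Finset.sum_congr rfl e1, ← Finset.sum_mul]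
    have e2 : z ^ (p + 2) * z⁻¹ ^ (p + 2) = 1 := by rw [← mul_pow, mul_inv_cancel₀ hz0, one_pow]
    have e3 : z ^ 2 * z⁻¹ ^ 2 = 1 := by rw [← mul_pow, mul_inv_cancel₀ hz0, one_pow]
    set T := ∑' n : ℕ, polePart (harmonic n) (harmonic n - (n : ℂ)⁻¹) p n z
    rw [show z⁻¹ ^ (p + 2) = z⁻¹ ^ p * z⁻¹ ^ 2 by ring] at h e2 ⊢
    linear_combination h + T * e2 - Real.pi * Complex.cot (Real.pi * z) *
        (Complex.digamma (-z) + Real.eulerMascheroniConstant) * z⁻¹ ^ p * e3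
  have h1 := aux _ hre hz
  have h2 := aux _ hre' (neg_ne_zero.2 hz)
  rw [tsum_mul_left, (summable_polePart hp hre).tsum_add (summable_polePart hp hre')]
  have e : ∑ j ∈ Finset.range (p + 2), PowerSeries.coeff j (cotLimPS * digammaLimPS) * ((-1) ^ m *
        (((m : ℂ) * Complex.I)⁻¹ ^ (p + 2 - j) + (-((m : ℂ) * Complex.I))⁻¹ ^ (p + 2 - j))) =
      (-1) ^ m * (∑ j ∈ Finset.range (p + 2), PowerSeries.coeff j (cotLimPS * digammaLimPS) *
        ((m : ℂ) * Complex.I)⁻¹ ^ (p + 2 - j) +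
        ∑ j ∈ Finset.range (p + 2), PowerSeries.coeff j (cotLimPS * digammaLimPS) *
        (-((m : ℂ) * Complex.I))⁻¹ ^ (p + 2 - j)) := by
    rw [← Finset.sum_add_distrib, Finset.mul_sum]
    exact Finset.sum_congr rfl fun j _ => by ring
  rw [e, ← mul_add, add_add_add_comm, ← h1, ← h2, neg_neg, imaginaryResidue]
  have hs := natCast_mul_pi_sinh_ne_zero hm
  have hcot : Complex.cot (Real.pi * ((m : ℂ) * Complex.I)) =
      -Complex.I * (Complex.cosh (m * Real.pi) / Complex.sinh (m * Real.pi)) := by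
    rw [Complex.cot, ← mul_assoc, Complex.cos_mul_I, Complex.sin_mul_I, mul_comm (Real.pi : ℂ)]
    field_simp
    rw [Complex.I_sq]
    ring
  rw [mul_neg, show Complex.cot (-(Real.pi * ((m : ℂ) * Complex.I))) =
    -Complex.cot (Real.pi * ((m : ℂ) * Complex.I)) by
      rw [Complex.cot, Complex.cot, Complex.cos_neg, Complex.sin_neg, div_neg], hcot, inv_neg,
    neg_pow ((m : ℂ) * Complex.I)⁻¹, mul_inv, Complex.inv_I, mul_pow, neg_pow Complex.I, inv_pow]
  have hsq : (-1 : ℂ) ^ p * (-1) ^ p = 1 := by rw [← mul_pow]; simp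
  rw [pow_succ (-1 : ℂ) p, pow_succ Complex.I p, div_eq_mul_inv _ ((m : ℂ) ^ p)]
  linear_combination (-(-1 : ℂ) ^ m * (Real.pi * (Complex.cosh (m * Real.pi) /
    Complex.sinh (m * Real.pi))) * ((m : ℂ) ^ p)⁻¹ * Complex.I ^ p * Complex.I *
    (Complex.digamma (m * Complex.I) + Real.eulerMascheroniConstant)) * hsq

/-- Adding and subtracting c_(p+2) completes two sums at once: it is the term m = 0 of the pole
sums, and the term j = p + 2 of the Cauchy product with the series of πx / sinh(πx). -/
theorem tendsto_sum_imaginaryResidue {p : ℕ} (hp : 1 ≤ p) :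
    Tendsto (fun M => ∑ m ∈ Finset.Icc 1 M, imaginaryResidue p m) atTop
      (𝓝 (∑' n, residuePart p n -
        PowerSeries.coeff (p + 2) (cotLimPS * digammaLimPS * cschLimPS))) := by
  have hc : PowerSeries.coeff (p + 2) (cotLimPS * digammaLimPS * cschLimPS) =
      ∑ j ∈ Finset.range (p + 2), PowerSeries.coeff j (cotLimPS * digammaLimPS) *
        PowerSeries.coeff (p + 2 - j) cschLimPS +
        PowerSeries.coeff (p + 2) (cotLimPS * digammaLimPS) := by
    rw [PowerSeries.coeff_mul, Finset.Nat.sum_antidiagonal_eq_sum_range_succ_mk,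
      Finset.sum_range_succ, Nat.sub_self]
    have : PowerSeries.coeff 0 cschLimPS = 1 := by rw [cschLimPS, PowerSeries.coeff_mk, if_pos rfl]
    rw [this, mul_one]
  have h1 : Tendsto (fun M : ℕ => ∑ j ∈ Finset.range (p + 2),
      PowerSeries.coeff j (cotLimPS * digammaLimPS) * ∑ m ∈ Finset.Icc 1 M, ((-1) ^ m *
        (((m : ℂ) * Complex.I)⁻¹ ^ (p + 2 - j) + (-((m : ℂ) * Complex.I))⁻¹ ^ (p + 2 - j)))) atTop
      (𝓝 (∑ j ∈ Finset.range (p + 2), PowerSeries.coeff j (cotLimPS * digammaLimPS) *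
        -PowerSeries.coeff (p + 2 - j) cschLimPS)) :=
    tendsto_finsetSum _ fun j hj => (tendsto_sum_alternating_inv_mul_I_pow (by
      have := Finset.mem_range.1 hj
      omega)).const_mul _
  have h2 := (h1.add (tendsto_tsum_polePart hp)).sub_const
    (PowerSeries.coeff (p + 2) (cotLimPS * digammaLimPS))
  convert! h2 using 2 with M
  · have hs : ∀ m ∈ Finset.Icc 1 M, Summable fun n : ℕ => (-1) ^ m *
        (polePart (harmonic n) (harmonic n - (n : ℂ)⁻¹) p n (m * Complex.I) +
          polePart (harmonic n) (harmonic n - (n : ℂ)⁻¹) p n (-(m * Complex.I))) := fun m _ =>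
      ((summable_polePart hp (by simp)).add (summable_polePart hp (by simp))).mul_left _
    rw [(summable_polePart hp Complex.zero_re).tsum_add (summable_sum hs),
      ← coeff_cotLimPS_mul_digammaLimPS hp, Summable.tsum_finsetSum hs,
      Finset.sum_congr rfl fun m hm => imaginaryResidue_eq hp (Finset.mem_Icc.1 hm).1,
      Finset.sum_add_distrib, Finset.sum_comm]
    simp_rw [← Finset.mul_sum]
    ring
  · rw [hc]
    simp_rw [mul_neg, Finset.sum_neg_distrib]
    ring

/-! ### The residue at 0 as sums of zeta values -/

theorem coeff_mul_of_even {A B : PowerSeries ℂ}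
    (hA : ∀ k, (∀ a, 1 ≤ a → k ≠ 2 * a) → PowerSeries.coeff k A = 0)
    (hB : ∀ k, (∀ a, 1 ≤ a → k ≠ 2 * a) → PowerSeries.coeff k B = 0) (m : ℕ) :
    PowerSeries.coeff m (A * B) =
      ∑ n ∈ Finset.Icc 1 m ×ˢ Finset.Icc 1 m with 2 * n.1 + 2 * n.2 = m,
        PowerSeries.coeff (2 * n.1) A * PowerSeries.coeff (2 * n.2) B := by
  rw [PowerSeries.coeff_mul]
  symm
  refine Finset.sum_of_injOn (fun n => (2 * n.1, 2 * n.2)) ?_ ?_ ?_ (fun n _ => rfl)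
  · rintro ⟨a, b⟩ _ ⟨c, d⟩ _ h
    simp only [Prod.mk.injEq] at h ⊢
    omega
  · rintro ⟨a, b⟩ h
    simp only [Finset.coe_filter, Finset.mem_product, Finset.mem_Icc, Set.mem_ofPred_eq,
      Finset.mem_coe, Finset.HasAntidiagonal.mem_antidiagonal] at h ⊢
    omega
  · rintro ⟨k, l⟩ hkl hne
    rw [Finset.HasAntidiagonal.mem_antidiagonal] at hkl
    simp only at hkl ⊢
    by_contra h0
    have h1 : ∃ a, 1 ≤ a ∧ k = 2 * a := by
      by_contra! h
      exact h0 (by rw [hA k h, zero_mul])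
    have h2 : ∃ a, 1 ≤ a ∧ l = 2 * a := by
      by_contra! h
      exact h0 (by rw [hB l h, mul_zero])
    obtain ⟨a, ha, rfl⟩ := h1
    obtain ⟨b, hb, rfl⟩ := h2
    refine hne ⟨(a, b), ?_, rfl⟩
    simp only [Finset.coe_filter, Finset.mem_product, Finset.mem_Icc, Set.mem_ofPred_eq]
    omega

theorem coeff_mul_of_even_of_two_le {A D : PowerSeries ℂ}
    (hA : ∀ k, (∀ a, 1 ≤ a → k ≠ 2 * a) → PowerSeries.coeff k A = 0)
    (hD : ∀ k, (∀ d, 1 ≤ d → k ≠ d + 1) → PowerSeries.coeff k D = 0) (m : ℕ) :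
    PowerSeries.coeff (m + 1) (A * D) =
      ∑ n ∈ Finset.Icc 1 m ×ˢ Finset.Icc 1 m with 2 * n.1 + n.2 = m,
        PowerSeries.coeff (2 * n.1) A * PowerSeries.coeff (n.2 + 1) D := by
  rw [PowerSeries.coeff_mul]
  symm
  refine Finset.sum_of_injOn (fun n => (2 * n.1, n.2 + 1)) ?_ ?_ ?_ (fun n _ => rfl)
  · rintro ⟨a, b⟩ _ ⟨c, d⟩ _ h
    simp only [Prod.mk.injEq] at h ⊢
    omega
  · rintro ⟨a, b⟩ h
    simp only [Finset.coe_filter, Finset.mem_product, Finset.mem_Icc, Set.mem_ofPred_eq,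
      Finset.mem_coe, Finset.HasAntidiagonal.mem_antidiagonal] at h ⊢
    omega
  · rintro ⟨k, l⟩ hkl hne
    rw [Finset.HasAntidiagonal.mem_antidiagonal] at hkl
    simp only at hkl ⊢
    by_contra h0
    have h1 : ∃ a, 1 ≤ a ∧ k = 2 * a := by
      by_contra! h
      exact h0 (by rw [hA k h, zero_mul])
    have h2 : ∃ d, 1 ≤ d ∧ l = d + 1 := by
      by_contra! h
      exact h0 (by rw [hD l h, mul_zero])
    obtain ⟨a, ha, rfl⟩ := h1
    obtain ⟨d, hd, rfl⟩ := h2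
    refine hne ⟨(a, d), ?_, rfl⟩
    simp only [Finset.coe_filter, Finset.mem_product, Finset.mem_Icc, Set.mem_ofPred_eq]
    omega

theorem coeff_mul_mul_of_even_of_two_le {A B D : PowerSeries ℂ}
    (hA : ∀ k, (∀ a, 1 ≤ a → k ≠ 2 * a) → PowerSeries.coeff k A = 0)
    (hB : ∀ k, (∀ a, 1 ≤ a → k ≠ 2 * a) → PowerSeries.coeff k B = 0)
    (hD : ∀ k, (∀ d, 1 ≤ d → k ≠ d + 1) → PowerSeries.coeff k D = 0) (m : ℕ) :
    PowerSeries.coeff (m + 1) (A * B * D) =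
      ∑ n ∈ Finset.Icc 1 m ×ˢ Finset.Icc 1 m ×ˢ Finset.Icc 1 m
          with 2 * n.1 + 2 * n.2.1 + n.2.2 = m,
        PowerSeries.coeff (2 * n.1) A * PowerSeries.coeff (2 * n.2.1) B *
          PowerSeries.coeff (n.2.2 + 1) D := by
  rw [PowerSeries.coeff_mul]
  simp_rw [PowerSeries.coeff_mul, Finset.sum_mul]
  rw [Finset.sum_sigma']
  symm
  refine Finset.sum_of_injOn
    (fun n => ⟨(2 * n.1 + 2 * n.2.1, n.2.2 + 1), (2 * n.1, 2 * n.2.1)⟩) ?_ ?_ ?_ (fun n _ => rfl)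
  · rintro ⟨a, b, c⟩ _ ⟨a', b', c'⟩ _ h
    simp only [Sigma.mk.injEq, Prod.mk.injEq, heq_eq_eq] at h ⊢
    omega
  · rintro ⟨a, b, c⟩ h
    simp only [Finset.coe_filter, Finset.mem_product, Finset.mem_Icc, Set.mem_ofPred_eq] at h
    exact Finset.mem_sigma.2 ⟨Finset.HasAntidiagonal.mem_antidiagonal.2 (by dsimp only; omega),
      Finset.HasAntidiagonal.mem_antidiagonal.2 rfl⟩
  · rintro ⟨⟨u, l⟩, ⟨k, j⟩⟩ hkl hne
    simp only [Finset.mem_sigma, Finset.HasAntidiagonal.mem_antidiagonal] at hkl ⊢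
    by_contra h0
    have h1 : ∃ a, 1 ≤ a ∧ k = 2 * a := by
      by_contra! h
      exact h0 (by rw [hA k h, zero_mul, zero_mul])
    have h2 : ∃ a, 1 ≤ a ∧ j = 2 * a := by
      by_contra! h
      exact h0 (by rw [hB j h, mul_zero, zero_mul])
    have h3 : ∃ d, 1 ≤ d ∧ l = d + 1 := by
      by_contra! h
      exact h0 (by rw [hD l h, mul_zero])
    obtain ⟨a, ha, rfl⟩ := h1
    obtain ⟨b, hb, rfl⟩ := h2
    obtain ⟨d, hd, rfl⟩ := h3
    obtain ⟨hkl1, rfl⟩ := hkl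
    refine hne ⟨(a, b, d), ?_, rfl⟩
    simp only [Finset.coe_filter, Finset.mem_product, Finset.mem_Icc, Set.mem_ofPred_eq]
    omega

theorem I_pow_two_mul_add (a : ℕ) :
    Complex.I ^ (2 * a) + (-Complex.I) ^ (2 * a) = 2 * (-1) ^ a := by
  rw [pow_mul, pow_mul, neg_sq, Complex.I_sq]
  ring

theorem I_pow_add_neg_I_pow_of_odd {k : ℕ} (hk : Odd k) :
    Complex.I ^ k + (-Complex.I) ^ k = 0 := by
  rw [hk.neg_pow, add_neg_cancel]

theorem coeff_eq_zero_of_forall_ne_two_mul {f : PowerSeries ℂ} (h0 : PowerSeries.coeff 0 f = 0)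
    (hodd : ∀ k, Odd k → PowerSeries.coeff k f = 0) (k : ℕ) (hk : ∀ a, 1 ≤ a → k ≠ 2 * a) :
    PowerSeries.coeff k f = 0 := by
  rcases Nat.even_or_odd' k with ⟨a, rfl | rfl⟩
  · rcases Nat.eq_zero_or_pos a with rfl | ha
    · exact h0
    · exact absurd rfl (hk a ha)
  · exact hodd _ ⟨a, rfl⟩

/-- Each factor is 1 plus a series starting in degree 2, here B, D, C, with B and C even. Of the
eight products, single factors give the ζ(p + 2) term, C B the first finite sum, C D and B D
together the second, and C B D the third. -/
theorem coeff_cotLimPS_mul_digammaLimPS_mul_cschLimPS (p : ℕ) :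
    PowerSeries.coeff (p + 2) (cotLimPS * digammaLimPS * cschLimPS) =
      riemannZeta (p + 2) *
        ((1 + (-1) ^ p) * (1 - (2 : ℂ) ^ (-(p : ℤ) - 1)) * (-1) ^ (p / 2 + 1) - 2 - (-1) ^ p)
      - 2 * (1 + (-1) ^ p) *
          ∑ n ∈ Finset.Icc 1 (p + 2) ×ˢ Finset.Icc 1 (p + 2) with 2 * n.1 + 2 * n.2 = p + 2,
            (1 - (2 : ℂ) ^ (1 - 2 * (n.1 : ℤ))) * (-1) ^ n.1 *
              riemannZeta (2 * n.1) * riemannZeta (2 * n.2)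
      + 2 *
          ∑ n ∈ Finset.Icc 1 (p + 1) ×ˢ Finset.Icc 1 (p + 1) with 2 * n.1 + n.2 = p + 1,
            (1 - (1 - (2 : ℂ) ^ (1 - 2 * (n.1 : ℤ))) * (-1) ^ n.1) *
              riemannZeta (2 * n.1) * riemannZeta (n.2 + 1)
      + 4 *
          ∑ n ∈ Finset.Icc 1 (p + 1) ×ˢ Finset.Icc 1 (p + 1) ×ˢ Finset.Icc 1 (p + 1)
              with 2 * n.1 + 2 * n.2.1 + n.2.2 = p + 1,
            (1 - (2 : ℂ) ^ (1 - 2 * (n.1 : ℤ))) * (-1) ^ n.1 *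
              riemannZeta (2 * n.1) * riemannZeta (2 * n.2.1) * riemannZeta (n.2.2 + 1) := by
  set B := cotLimPS - 1 with hBdef
  set D := digammaLimPS - 1 with hDdef
  set C := cschLimPS - 1 with hCdef
  have cB : ∀ k, 2 ≤ k → PowerSeries.coeff k B = -((1 + (-1) ^ k) * riemannZeta k) := by
    intro k hk
    rw [hBdef, map_sub, PowerSeries.coeff_one, if_neg (by omega), cotLimPS, PowerSeries.coeff_mk,
      if_neg (by omega), if_neg (by omega), sub_zero]
  have cD : ∀ k, 2 ≤ k → PowerSeries.coeff k D = -riemannZeta k := by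
    intro k hk
    rw [hDdef, map_sub, PowerSeries.coeff_one, if_neg (by omega), digammaLimPS,
      PowerSeries.coeff_mk, if_neg (by omega), if_neg (by omega), sub_zero]
  have cC : ∀ k, 2 ≤ k → PowerSeries.coeff k C =
      (Complex.I ^ k + (-Complex.I) ^ k) * ((1 - 2 * 2⁻¹ ^ k) * riemannZeta k) := by
    intro k hk
    rw [hCdef, map_sub, PowerSeries.coeff_one, if_neg (by omega), cschLimPS,
      PowerSeries.coeff_mk, if_neg (by omega), if_neg (by omega), sub_zero]
  have hB : ∀ k, (∀ a, 1 ≤ a → k ≠ 2 * a) → PowerSeries.coeff k B = 0 := by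
    refine coeff_eq_zero_of_forall_ne_two_mul (by simp [hBdef, cotLimPS]) fun k hk => ?_
    rcases eq_or_ne k 1 with rfl | h1
    · simp [hBdef, cotLimPS, PowerSeries.coeff_one]
    · obtain ⟨j, rfl⟩ := hk
      rw [cB _ (by omega), Odd.neg_one_pow ⟨j, rfl⟩]
      ring
  have hC : ∀ k, (∀ a, 1 ≤ a → k ≠ 2 * a) → PowerSeries.coeff k C = 0 := by
    refine coeff_eq_zero_of_forall_ne_two_mul (by simp [hCdef, cschLimPS]) fun k hk => ?_
    rcases eq_or_ne k 1 with rfl | h1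
    · simp [hCdef, cschLimPS, PowerSeries.coeff_one]
    · obtain ⟨j, rfl⟩ := hk
      rw [cC _ (by omega), I_pow_add_neg_I_pow_of_odd ⟨j, rfl⟩, zero_mul]
  have hD : ∀ k, (∀ d, 1 ≤ d → k ≠ d + 1) → PowerSeries.coeff k D = 0 := by
    intro k hk
    rcases k with _ | _ | k
    · simp [hDdef, digammaLimPS]
    · simp [hDdef, digammaLimPS, PowerSeries.coeff_one]
    · exact absurd rfl (hk (k + 1) (by omega))
  have hprod : cotLimPS * digammaLimPS * cschLimPS =
      1 + B + D + C + C * B + C * D + B * D + C * B * D := by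
    rw [hBdef, hDdef, hCdef]
    ring
  have vC : ∀ a : ℕ, 1 ≤ a → PowerSeries.coeff (2 * a) C =
      2 * ((1 - (2 : ℂ) ^ (1 - 2 * (a : ℤ))) * (-1) ^ a * riemannZeta (2 * a)) := by
    intro a ha
    have : (2 : ℂ) ^ (1 - 2 * (a : ℤ)) = 2 * 2⁻¹ ^ (2 * a) := by
      rw [zpow_sub₀ two_ne_zero, zpow_one, inv_pow, div_eq_mul_inv]
      norm_cast
    rw [cC _ (by omega), I_pow_two_mul_add, this]
    push_cast
    ring
  have vB : ∀ a : ℕ, 1 ≤ a → PowerSeries.coeff (2 * a) B = -2 * riemannZeta (2 * a) := by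
    intro a ha
    rw [cB _ (by omega), pow_mul, neg_one_sq, one_pow]
    push_cast
    ring
  have vD : ∀ d : ℕ, 1 ≤ d → PowerSeries.coeff (d + 1) D = -riemannZeta (d + 1) := by
    intro d hd
    rw [cD _ (by omega)]
    push_cast
    rfl
  have tC : PowerSeries.coeff (p + 2) C = riemannZeta (p + 2) *
      ((1 + (-1) ^ p) * (1 - (2 : ℂ) ^ (-(p : ℤ) - 1)) * (-1) ^ (p / 2 + 1)) := by
    have h2 : (2 : ℂ) ^ (-(p : ℤ) - 1) = 2 * 2⁻¹ ^ (p + 2) := by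
      rw [show -(p : ℤ) - 1 = -((p + 1 : ℕ) : ℤ) by push_cast; ring, zpow_neg, zpow_natCast,
        pow_succ _ (p + 1), inv_pow]
      norm_num
      ring
    rw [cC _ (by omega), h2]
    push_cast
    rcases Nat.even_or_odd' p with ⟨q, rfl | rfl⟩
    · rw [show 2 * q + 2 = 2 * (q + 1) by ring, I_pow_two_mul_add, Nat.mul_div_cancel_left _ two_pos,
        (even_two_mul q).neg_one_pow]
      ring
    · rw [I_pow_add_neg_I_pow_of_odd ⟨q + 1, by ring⟩, Odd.neg_one_pow ⟨q, rfl⟩]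
      ring
  have tB : PowerSeries.coeff (p + 2) B = -(1 + (-1) ^ p) * riemannZeta (p + 2) := by
    rw [cB _ (by omega)]
    push_cast
    ring
  have tD : PowerSeries.coeff (p + 2) D = -riemannZeta (p + 2) := by
    rw [cD _ (by omega)]
    push_cast
    rfl
  have tCB : PowerSeries.coeff (p + 2) (C * B) = -2 * (1 + (-1) ^ p) *
      ∑ n ∈ Finset.Icc 1 (p + 2) ×ˢ Finset.Icc 1 (p + 2) with 2 * n.1 + 2 * n.2 = p + 2,
        (1 - (2 : ℂ) ^ (1 - 2 * (n.1 : ℤ))) * (-1) ^ n.1 *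
          riemannZeta (2 * n.1) * riemannZeta (2 * n.2) := by
    rw [coeff_mul_of_even hC hB, Finset.mul_sum]
    refine Finset.sum_congr rfl fun n hn => ?_
    simp only [Finset.mem_filter, Finset.mem_product, Finset.mem_Icc] at hn
    -- An index pair exists only for even p, where 1 + (-1)^p = 2; for odd p the sum is empty and
    -- the factor is harmless.
    rw [vC _ hn.1.1.1, vB _ hn.1.2.1, Even.neg_one_pow (n := p) (by rw [Nat.even_iff]; omega)]
    ring
  have tCD : PowerSeries.coeff (p + 2) (C * D) + PowerSeries.coeff (p + 2) (B * D) = 2 *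
      ∑ n ∈ Finset.Icc 1 (p + 1) ×ˢ Finset.Icc 1 (p + 1) with 2 * n.1 + n.2 = p + 1,
        (1 - (1 - (2 : ℂ) ^ (1 - 2 * (n.1 : ℤ))) * (-1) ^ n.1) *
          riemannZeta (2 * n.1) * riemannZeta (n.2 + 1) := by
    rw [coeff_mul_of_even_of_two_le hC hD, coeff_mul_of_even_of_two_le hB hD,
      ← Finset.sum_add_distrib, Finset.mul_sum]
    refine Finset.sum_congr rfl fun n hn => ?_
    simp only [Finset.mem_filter, Finset.mem_product, Finset.mem_Icc] at hn
    rw [vC _ hn.1.1.1, vB _ hn.1.1.1, vD _ hn.1.2.1]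
    ring
  have tCBD : PowerSeries.coeff (p + 2) (C * B * D) = 4 *
      ∑ n ∈ Finset.Icc 1 (p + 1) ×ˢ Finset.Icc 1 (p + 1) ×ˢ Finset.Icc 1 (p + 1)
          with 2 * n.1 + 2 * n.2.1 + n.2.2 = p + 1,
        (1 - (2 : ℂ) ^ (1 - 2 * (n.1 : ℤ))) * (-1) ^ n.1 *
          riemannZeta (2 * n.1) * riemannZeta (2 * n.2.1) * riemannZeta (n.2.2 + 1) := by
    rw [coeff_mul_mul_of_even_of_two_le hC hB hD, Finset.mul_sum]
    refine Finset.sum_congr rfl fun n hn => ?_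
    simp only [Finset.mem_filter, Finset.mem_product, Finset.mem_Icc] at hn
    rw [vC _ hn.1.1.1, vB _ hn.1.2.1.1, vD _ hn.1.2.2.1]
    ring
  rw [hprod]
  simp only [map_add]
  rw [PowerSeries.coeff_one, if_neg (by omega), tB, tD, tC, tCB, tCBD]
  linear_combination tCD

/-! ### Convergence of the real series and conclusion -/

theorem seriesSum_of_summable {f : ℕ → ℝ} (hf : Summable f) (h0 : f 0 = 0) :
    SeriesSum f (∑' n, f n) := by
  have h := hf.hasSum
  rw [← hasSum_nat_add_iff' 1, Finset.sum_range_one, h0, sub_zero] at h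
  refine h.tendsto_sum_nat.congr fun N => ?_
  rw [sum_Icc_eq_sum_range_succ]

theorem pi_div_sinh_nonneg (n : ℕ) : 0 ≤ Real.pi / Real.sinh (n * Real.pi) :=
  div_nonneg Real.pi_pos.le (Real.sinh_nonneg_iff.2 (by positivity))

theorem pi_div_sinh_le {n : ℕ} (hn : 1 ≤ n) :
    Real.pi / Real.sinh (n * Real.pi) ≤ (n : ℝ)⁻¹ := by
  have hn0 : (0 : ℝ) < n := by exact_mod_cast hn
  have h : (n : ℝ) * Real.pi ≤ Real.sinh (n * Real.pi) := Real.self_le_sinh_iff.2 (by positivity)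
  rw [div_le_iff₀ (lt_of_lt_of_le (by positivity) h), inv_mul_eq_div, le_div_iff₀ hn0]
  linarith

theorem summable_harmonic_div_sinh {p : ℕ} (hp : 1 ≤ p) :
    Summable fun n : ℕ =>
      Real.pi * (harmonic n : ℝ) / ((n : ℝ) ^ p * Real.sinh (n * Real.pi)) := by
  refine Summable.of_nonneg_of_le (fun n => ?_) (fun n => ?_)
    (summable_inv_sq_mul_sqrt.mul_left 3)
  · have := harmonic_nonneg n
    have := Real.sinh_nonneg_iff.2 (by positivity : 0 ≤ n * Real.pi)
    positivity
  · rcases Nat.eq_zero_or_pos n with rfl | hn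
    · simp
    · have h1 := harmonic_le_sqrt hn
      have h2 := pi_div_sinh_le hn
      have h3 := inv_natCast_pow_le hn hp
      have h4 := harmonic_nonneg n
      have h5 := pi_div_sinh_nonneg n
      calc Real.pi * (harmonic n : ℝ) / ((n : ℝ) ^ p * Real.sinh (n * Real.pi))
          = (n : ℝ)⁻¹ ^ p * harmonic n * (Real.pi / Real.sinh (n * Real.pi)) := by ring
        _ ≤ (n : ℝ)⁻¹ * (3 * √n) * (n : ℝ)⁻¹ := by gcongr
        _ = _ := by ring

theorem summable_pi_div_sinh (p : ℕ) :
    Summable fun n : ℕ => Real.pi / ((n : ℝ) ^ (p + 1) * Real.sinh (n * Real.pi)) := by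
  refine Summable.of_nonneg_of_le (fun n => ?_) (fun n => ?_) summable_inv_sq_mul_sqrt
  · have := Real.sinh_nonneg_iff.2 (by positivity : 0 ≤ n * Real.pi)
    positivity
  · rcases Nat.eq_zero_or_pos n with rfl | hn
    · simp
    · have h1 := one_le_sqrt_natCast hn
      have h2 := pi_div_sinh_le hn
      have h3 := inv_natCast_pow_le hn (by omega : 1 ≤ p + 1)
      have h5 := pi_div_sinh_nonneg n
      calc Real.pi / ((n : ℝ) ^ (p + 1) * Real.sinh (n * Real.pi))
          = (n : ℝ)⁻¹ ^ (p + 1) * 1 * (Real.pi / Real.sinh (n * Real.pi)) := by ring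
        _ ≤ (n : ℝ)⁻¹ * √n * (n : ℝ)⁻¹ := by gcongr
        _ = _ := by ring

/-- No estimate of cosh / sinh² is needed: the bound on `cschDerivSum` is uniform in M and passes to
its limit. -/
theorem summable_cosh_div_sinh_sq {p : ℕ} (hp : 1 ≤ p) :
    Summable fun n : ℕ => Real.pi ^ 2 * Real.cosh (n * Real.pi) /
      ((n : ℝ) ^ p * Real.sinh (n * Real.pi) ^ 2) := by
  obtain ⟨K, hK0, hK⟩ := exists_norm_cschDerivSum_le
  refine Summable.of_nonneg_of_le (fun n => ?_) (fun n => ?_)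
    (summable_inv_sq_mul_sqrt.mul_left K)
  · have := Real.cosh_pos (n * Real.pi)
    positivity
  · rcases Nat.eq_zero_or_pos n with rfl | hn
    · simp
    · have h1 := le_of_tendsto (tendsto_pi_sq_mul_cosh_div_sinh_sq hn).norm
        (Eventually.of_forall fun M => hK M n hn)
      have e : Real.pi ^ 2 * Complex.cosh (n * Real.pi) / Complex.sinh (n * Real.pi) ^ 2 =
          ((Real.pi ^ 2 * Real.cosh (n * Real.pi) / Real.sinh (n * Real.pi) ^ 2 : ℝ) : ℂ) := by
        push_cast
        rfl
      have h0 : 0 ≤ Real.pi ^ 2 * Real.cosh (n * Real.pi) / Real.sinh (n * Real.pi) ^ 2 := by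
        have := Real.cosh_pos (n * Real.pi)
        positivity
      rw [e, Complex.norm_real, Real.norm_of_nonneg h0] at h1
      have h3 := inv_natCast_pow_le hn hp
      calc Real.pi ^ 2 * Real.cosh (n * Real.pi) / ((n : ℝ) ^ p * Real.sinh (n * Real.pi) ^ 2)
          = (n : ℝ)⁻¹ ^ p *
            (Real.pi ^ 2 * Real.cosh (n * Real.pi) / Real.sinh (n * Real.pi) ^ 2) := by ring
        _ ≤ (n : ℝ)⁻¹ * (K * ((n : ℝ)⁻¹ * √n)) := by gcongr
        _ = _ := by ring

theorem tsum_residuePart {p : ℕ} (hp : 1 ≤ p) :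
    ∑' n, residuePart p n =
      ((∑' n : ℕ, Real.pi ^ 2 * Real.cosh (n * Real.pi) /
        ((n : ℝ) ^ p * Real.sinh (n * Real.pi) ^ 2) : ℝ) : ℂ) +
      (p - (-1) ^ p) *
        ((∑' n : ℕ, Real.pi / ((n : ℝ) ^ (p + 1) * Real.sinh (n * Real.pi)) : ℝ) : ℂ) +
      ((-1) ^ p - 1) * ((∑' n : ℕ, Real.pi * (harmonic n : ℝ) /
        ((n : ℝ) ^ p * Real.sinh (n * Real.pi)) : ℝ) : ℂ) := by
  have h1 := Complex.hasSum_ofReal.2 (summable_harmonic_div_sinh hp).hasSum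
  have h2 := Complex.hasSum_ofReal.2 (summable_pi_div_sinh p).hasSum
  have h3 := Complex.hasSum_ofReal.2 (summable_cosh_div_sinh_sq hp).hasSum
  refine HasSum.tsum_eq (((h3.add (h2.mul_left _)).add (h1.mul_left _)).congr_fun fun n => ?_)
  rw [residuePart]
  push_cast
  ring

theorem theorem5p1 (p : ℕ) (hp : 1 ≤ p) :
    ∃ (S₁ S₂ S₃ : ℝ) (S₄ : ℂ),
      SeriesSum (fun n : ℕ =>
        Real.pi * (harmonic n : ℝ) / ((n : ℝ) ^ p * Real.sinh (n * Real.pi))) S₁ ∧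
      SeriesSum (fun n : ℕ =>
        Real.pi / ((n : ℝ) ^ (p + 1) * Real.sinh (n * Real.pi))) S₂ ∧
      SeriesSum (fun n : ℕ =>
        Real.pi ^ 2 * Real.cosh (n * Real.pi) /
          ((n : ℝ) ^ p * Real.sinh (n * Real.pi) ^ 2)) S₃ ∧
      SeriesSum (fun n : ℕ =>
        (-1 : ℂ) ^ n *
          (Real.pi * (Complex.cosh (n * Real.pi) / Complex.sinh (n * Real.pi)) / (n : ℂ) ^ p) *
          Complex.I ^ (p + 1) *
          (Complex.digamma (n * Complex.I) + (-1) ^ (p + 1) * Complex.digamma (-(n * Complex.I))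
            + (1 + (-1) ^ (p + 1)) * Real.eulerMascheroniConstant)) S₄ ∧
      (1 + (-1 : ℂ) ^ (p + 1)) * S₁ - ((p : ℂ) + (-1) ^ (p + 1)) * S₂ - S₃ + S₄
        + riemannZeta (p + 2) *
            ((1 + (-1) ^ p) * (1 - (2 : ℂ) ^ (-(p : ℤ) - 1)) * (-1) ^ (p / 2 + 1) - 2 - (-1) ^ p)
        - 2 * (1 + (-1) ^ p) *
            ∑ n ∈ Finset.Icc 1 (p + 2) ×ˢ Finset.Icc 1 (p + 2) with 2 * n.1 + 2 * n.2 = p + 2,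
              (1 - (2 : ℂ) ^ (1 - 2 * (n.1 : ℤ))) * (-1) ^ n.1 *
                riemannZeta (2 * n.1) * riemannZeta (2 * n.2)
        + 2 *
            ∑ n ∈ Finset.Icc 1 (p + 1) ×ˢ Finset.Icc 1 (p + 1) with 2 * n.1 + n.2 = p + 1,
              (1 - (1 - (2 : ℂ) ^ (1 - 2 * (n.1 : ℤ))) * (-1) ^ n.1) *
                riemannZeta (2 * n.1) * riemannZeta (n.2 + 1)
        + 4 *
            ∑ n ∈ Finset.Icc 1 (p + 1) ×ˢ Finset.Icc 1 (p + 1) ×ˢ Finset.Icc 1 (p + 1)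
                with 2 * n.1 + 2 * n.2.1 + n.2.2 = p + 1,
              (1 - (2 : ℂ) ^ (1 - 2 * (n.1 : ℤ))) * (-1) ^ n.1 *
                riemannZeta (2 * n.1) * riemannZeta (2 * n.2.1) * riemannZeta (n.2.2 + 1)
        = 0 := by
  -- The terms at n = 0 vanish because division by zero gives 0, so sums over ℕ start at 1. The
  -- fourth series is obtained only as a limit of partial sums.
  refine ⟨_, _, _, _, seriesSum_of_summable (summable_harmonic_div_sinh hp) (by simp),
    seriesSum_of_summable (summable_pi_div_sinh p) (by simp),
    seriesSum_of_summable (summable_cosh_div_sinh_sq hp) (by simp),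
    tendsto_sum_imaginaryResidue hp, ?_⟩
  rw [tsum_residuePart hp, coeff_cotLimPS_mul_digammaLimPS_mul_cschLimPS]
  ring
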